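/- Let $d\ge 2$ and write $\hat f$ for the Fourier transform. For a tempered distribution $f$ on $\mathbb R^d$ and $s\in\mathbb R$, let $\||\nabla|^s f\|_{L^2(\mathbb R^d)}\in[0,\infty]$ be the $L^2$ norm of the function $|\nabla|^s f$ whose Fourier transform is $|2\pi\xi|^s\hat f(\xi)$ (with $\hat f(\xi)=\int e^{-2\pi i x\cdot\xi}f(x)\,dx$); it is $\infty$ if $\hat f$ is not a function or if $|2\pi\xi|^s\hat f\notin L^2$. For $t>0$ let $(e^{t\Delta}f)(x)=\langle f, K_t(x-\cdot)\rangle$ with the heat kernel $K_t(x)=(4\pi t)^{-d/2}e^{-|x|^2/(4t)}$. All norms in space-time are over $(t,x)\in\mathbb R^+\times\mathbb R^d$ with $\mathbb R^+=(0,\infty)$. (i) Let $q\in(2,\infty)$ and $\delta\in\left(\frac12-\frac3q,\,1-\frac4q\right)$. There is a constant $C=C(d,q,\delta)<\infty$ such that for every radial (that is, $O(d)$-invariant) tempered distribution $f$ with $\operatorname{supp} f\subset\{x:|x|\ge 1\}$ (in particular for every such $f$ in some Sobolev space $H^\gamma(\mathbb R^d)$, $\gamma\in\mathbb R$), $$\|e^{t\Delta}f\|_{L^q_{t,x}(\mathbb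 R^+\times\mathbb R^d)}\le C\,\||\nabla|^\delta f\|_{L^2(\mathbb R^d)}.$$ (ii) Let $\gamma_0\in\left[0,\frac{d-1}{d+2}\right)$. There is a constant $C=C(d,\gamma_0)<\infty$ such that for every radial tempered distribution $h_0$ with $\operatorname{supp} h_0\subset\{x:|x|\ge 1\}$, $$\|e^{t\Delta}h_0\|_{L^{2+4/d}_{t,x}(\mathbb R^+\times\mathbb R^d)}\le C\,\||\nabla|^{-\gamma_0}h_0\|_{L^2(\mathbb R^d)}=C\,\|h_0\|_{\dot H^{-\gamma_0}(\mathbb R^d)}.$$ -/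

import Mathlib

open MeasureTheory Set
open scoped ENNReal NNReal SchwartzMap FourierTransform

noncomputable section

/-- The heat kernel `(4πt)^{-d/2} exp(-|x|²/(4t))` on `ℝ^d`. -/
def heatKernelFun {d : ℕ} (t : ℝ) (x : EuclideanSpace ℝ (Fin d)) : ℝ :=
  (4 * Real.pi * t) ^ (-(d : ℝ) / 2) * Real.exp (-(1 / (4 * t)) * ‖x‖ ^ 2)

theorem contDiff_gaussian {d : ℕ} (c b : ℝ) :
    ContDiff ℝ ((⊤ : ℕ∞) : WithTop ℕ∞)
      (fun x : EuclideanSpace ℝ (Fin d) => c * Real.exp (-b * ‖x‖ ^ 2)) :=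
  contDiff_const.mul (Real.contDiff_exp.comp (contDiff_const.mul (contDiff_norm_sq ℝ)))

theorem gaussian_decay {d : ℕ} (c : ℝ) {b : ℝ} (hb : 0 < b) (k n : ℕ) :
    ∃ C : ℝ, ∀ x : EuclideanSpace ℝ (Fin d),
      ‖x‖ ^ k * ‖iteratedFDeriv ℝ n (fun x : EuclideanSpace ℝ (Fin d) =>
        c * Real.exp (-b * ‖x‖ ^ 2)) x‖ ≤ C := by
  obtain ⟨l, M, hM0, hM⟩ := (Function.hasTemperateGrowth_norm_sq
    (H := EuclideanSpace ℝ (Fin d))).norm_iteratedFDeriv_le_uniform n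
  set B : ℝ := |c| * (1 + b) ^ n with hB
  have hB0 : 0 ≤ B := by positivity
  refine ⟨n.factorial * B * (1 + M) ^ n * ((k + l * n).factorial * Real.exp (1 + 1 / (4 * b))),
    fun x => ?_⟩
  set r := ‖x‖ with hr
  have hr0 : 0 ≤ r := norm_nonneg x
  set D : ℝ := (1 + M) * (1 + r) ^ l with hD
  have hD1 : 1 ≤ D := by
    have h1 : (1 : ℝ) ≤ (1 + r) ^ l := one_le_pow₀ (by linarith)
    nlinarith
  have key : ‖iteratedFDeriv ℝ n ((fun s : ℝ => c * Real.exp (-b * s)) ∘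
      (fun x : EuclideanSpace ℝ (Fin d) => ‖x‖ ^ 2)) x‖
      ≤ n.factorial * (B * Real.exp (-b * r ^ 2)) * D ^ n := by
    refine norm_iteratedFDeriv_comp_le (N := ((⊤ : ℕ∞) : WithTop ℕ∞)) ?_ (contDiff_norm_sq ℝ)
      (by exact_mod_cast le_top) x ?_ ?_
    · exact contDiff_const.mul (Real.contDiff_exp.comp (contDiff_const.mul contDiff_id))
    · intro i hi
      rw [norm_iteratedFDeriv_eq_norm_iteratedDeriv, iteratedDeriv_const_mul_field]
      have : iteratedDeriv i (fun s : ℝ => Real.exp (-b * s))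
          = fun s => (-b) ^ i * Real.exp (-b * s) := by
        simpa using iteratedDeriv_exp_const_mul i (-b)
      rw [this, norm_mul, norm_mul, norm_pow, norm_neg, Real.norm_eq_abs, Real.norm_eq_abs,
        Real.norm_eq_abs, Real.abs_exp, abs_of_pos hb, ← mul_assoc]
      have h2 : b ^ i ≤ (1 + b) ^ n :=
        (pow_le_pow_left₀ hb.le (by linarith) i).trans (pow_le_pow_right₀ (by linarith) hi)
      rw [hB]
      gcongr
    · intro i hi1 hin
      calc _ ≤ M * (1 + r) ^ l := hM i hin x
        _ ≤ D := by rw [hD]; gcongr; linarith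
        _ ≤ D ^ i := le_self_pow₀ hD1 (by omega)
  have hpow : (1 + r) ^ (k + l * n) * Real.exp (-b * r ^ 2)
      ≤ (k + l * n).factorial * Real.exp (1 + 1 / (4 * b)) := by
    have h3 := Real.pow_div_factorial_le_exp (1 + r) (by linarith) (k + l * n)
    rw [div_le_iff₀ (by positivity)] at h3
    have h4 : (1 + r) + -b * r ^ 2 ≤ 1 + 1 / (4 * b) := by
      have h6 : b * (r - 1 / (2 * b)) ^ 2 = b * r ^ 2 - r + 1 / (4 * b) := by
        field_simp
        ring
      have h7 : 0 ≤ b * (r - 1 / (2 * b)) ^ 2 := by positivity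
      linarith
    calc _ ≤ (Real.exp (1 + r) * (k + l * n).factorial) * Real.exp (-b * r ^ 2) := by gcongr
      _ = (k + l * n).factorial * Real.exp ((1 + r) + -b * r ^ 2) := by rw [Real.exp_add (1 + r)]; ring
      _ ≤ _ := by gcongr
  calc r ^ k * _ ≤ (1 + r) ^ k * (n.factorial * (B * Real.exp (-b * r ^ 2)) * D ^ n) := by
        gcongr
        · linarith
        · exact key
    _ = n.factorial * B * (1 + M) ^ n * ((1 + r) ^ (k + l * n) * Real.exp (-b * r ^ 2)) := by
        rw [hD, mul_pow, pow_add, pow_mul]; ring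
    _ ≤ _ := by gcongr

/-- The heat kernel at time `t > 0` as a (complex valued) Schwartz function; it is set to `0`
for `t ≤ 0`, a range of times that is never used. -/
def heatKernel {d : ℕ} (t : ℝ) : 𝓢(EuclideanSpace ℝ (Fin d), ℂ) :=
  if ht : 0 < t then
    { toFun := fun x => (heatKernelFun t x : ℂ)
      smooth' := Complex.ofRealCLM.contDiff.comp (contDiff_gaussian _ _)
      decay' := fun k n => by
        obtain ⟨C, hC⟩ := gaussian_decay (d := d) ((4 * Real.pi * t) ^ (-(d : ℝ) / 2))
          (b := 1 / (4 * t)) (by positivity) k n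
        refine ⟨C, fun x => ?_⟩
        have h := Complex.ofRealLI.norm_iteratedFDeriv_comp_left
          (f := (heatKernelFun t : EuclideanSpace ℝ (Fin d) → ℝ)) (x := x)
          (contDiff_gaussian _ _).contDiffAt (i := n) (by exact_mod_cast le_top)
        have h' : ‖iteratedFDeriv ℝ n (fun x : EuclideanSpace ℝ (Fin d) =>
            (heatKernelFun t x : ℂ)) x‖ = ‖iteratedFDeriv ℝ n (heatKernelFun t) x‖ := h
        rw [h']
        exact hC x }
  else 0

theorem heatKernel_apply {d : ℕ} {t : ℝ} (ht : 0 < t) (x : EuclideanSpace ℝ (Fin d)) :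
    heatKernel t x = (heatKernelFun t x : ℂ) := by
  rw [heatKernel, dif_pos ht]; rfl

/-- The heat flow `(e^{tΔ} f)(x) = ⟨f, K_t(x - ·)⟩` of a tempered distribution `f`, where `K_t` is
the heat kernel; `K_t` is even, so that the test function is `y ↦ K_t(y - x)`. -/
def heatFlow {d : ℕ} (f : 𝓢'(EuclideanSpace ℝ (Fin d), ℂ)) (t : ℝ)
    (x : EuclideanSpace ℝ (Fin d)) : ℂ :=
  f ((heatKernel t).compSubConstCLM ℂ x)

/-- For `f ∈ L^p` the heat flow is the usual convolution with the heat kernel. -/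
theorem heatFlow_Lp {d : ℕ} {p : ℝ≥0∞} [Fact (1 ≤ p)]
    (f : Lp ℂ p (volume : Measure (EuclideanSpace ℝ (Fin d)))) {t : ℝ} (ht : 0 < t)
    (x : EuclideanSpace ℝ (Fin d)) :
    heatFlow (Lp.toTemperedDistribution f) t x = ∫ y, (heatKernelFun t (x - y) : ℂ) * f y := by
  rw [heatFlow, Lp.toTemperedDistribution_apply]
  refine integral_congr_ae (Filter.Eventually.of_forall fun y => ?_)
  simp only [SchwartzMap.compSubConstCLM_apply, heatKernel_apply ht, smul_eq_mul, heatKernelFun,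
    norm_sub_rev x y]

/-- The norm of `L^q_{t,x}(ℝ⁺ × ℝ^d)`, with values in `[0, ∞]`. -/
def spaceTimeNorm {d : ℕ} (q : ℝ) (u : ℝ → EuclideanSpace ℝ (Fin d) → ℂ) : ℝ≥0∞ :=
  eLpNorm (fun z : ℝ × EuclideanSpace ℝ (Fin d) => u z.1 z.2) (ENNReal.ofReal q)
    ((volume.restrict (Ioi (0 : ℝ))).prod volume)

/-- A tempered distribution is radial if it is invariant under all linear isometries of `ℝ^d`. -/
def IsRadialDistribution {d : ℕ} (f : 𝓢'(EuclideanSpace ℝ (Fin d), ℂ)) : Prop :=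
  ∀ (A : EuclideanSpace ℝ (Fin d) ≃ₗᵢ[ℝ] EuclideanSpace ℝ (Fin d))
    (φ : 𝓢(EuclideanSpace ℝ (Fin d), ℂ)),
    f (SchwartzMap.compCLMOfContinuousLinearEquiv ℂ A.toContinuousLinearEquiv φ) = f φ

/-- The Fourier transform of the tempered distribution `f` is the function `g`. -/
def HasFourierFunction {d : ℕ} (f : 𝓢'(EuclideanSpace ℝ (Fin d), ℂ))
    (g : EuclideanSpace ℝ (Fin d) → ℂ) : Prop :=
  ∀ φ : 𝓢(EuclideanSpace ℝ (Fin d), ℂ),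
    Integrable (fun ξ => φ ξ * g ξ) ∧ (𝓕 f) φ = ∫ ξ, φ ξ * g ξ

/-- `|∇|^δ f = h` with `h ∈ L²`: the Fourier transform of `f` is a function, and
`ĥ(ξ) = (2π|ξ|)^δ f̂(ξ)` for almost every `ξ`. The factor `2π` comes from the normalization
`f̂(ξ) = ∫ e^{-2πi x·ξ} f(x) dx` of the Fourier transform. -/
def IsFracDeriv {d : ℕ} (δ : ℝ) (f : 𝓢'(EuclideanSpace ℝ (Fin d), ℂ))
    (h : Lp ℂ 2 (volume : Measure (EuclideanSpace ℝ (Fin d)))) : Prop :=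
  ∃ g : EuclideanSpace ℝ (Fin d) → ℂ, HasFourierFunction f g ∧
    (𝓕 h : Lp ℂ 2 (volume : Measure (EuclideanSpace ℝ (Fin d)))) =ᵐ[volume]
      fun ξ => (((2 * Real.pi * ‖ξ‖) ^ δ : ℝ) : ℂ) * g ξ

/-- `‖|∇|^δ f‖_{L²}`, that is, the homogeneous Sobolev norm of `f` of order `δ`, with values in
`[0, ∞]`. It is `∞` if there is no `h ∈ L²` with `|∇|^δ f = h`; otherwise `h` is unique. -/
def fracDerivL2Norm {d : ℕ} (δ : ℝ) (f : 𝓢'(EuclideanSpace ℝ (Fin d), ℂ)) : ℝ≥0∞ :=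
  ⨅ (h : Lp ℂ 2 (volume : Measure (EuclideanSpace ℝ (Fin d)))) (_ : IsFracDeriv δ f h), ‖h‖ₑ

end

open scoped LineDeriv

noncomputable section

/-! Write ρ = 2π|ξ| and G = ρ^δ f̂. The norm on the right is ‖G‖₂, and u(t) = e^{tΔ}f is the inverse
Fourier transform of ρ^{-δ} e^{-tρ²} G. Space is split at |x| = 1/2; both parts of the theorem are
instances of `spaceTimeNorm_heatFlow_le`.

Exterior region (`exterior_estimate`). Since -δ may be negative, u is replaced by its time
derivative v = ∂ₜu, up to sign the transform of ρ^a e^{-tρ²} G with a = 2 - δ > 0. Hardy's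
inequality in t, for each fixed x, bounds ∫ |u|^q dt by ∫ t^q |v|^q dt. Radial Sobolev gives |v| ≲
t^{-a/2-1/4} ‖G‖₂ for |x| ≥ 1/2, and Cauchy–Schwarz in frequency gives |v| ≲ t^{-a/2-d/4} ‖G‖₂
everywhere, hence |v| ≲ t^{-a/2-κ/2} ‖G‖₂ for every κ in [1/2, d/2]. This bound is spent on q - 2 of
the factors of |v|^q. If δq + 2 = κ(q - 2), the remaining weight is t^{a-1}, and ∫∫ t^{a-1} |v|² dx
dt ≲ ‖G‖₂² by Plancherel and a Gamma integral. Support is not used in this region.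

Interior region (`interior_estimate`). For t ≤ 1 the support condition allows the singular part of
the heat kernel to be cut off. What remains is a test function under a fixed Gaussian, and its
pairing with f is bounded by ‖ρ^{-δ} φ̂‖₂ ‖G‖₂; the weight is harmless for -1 ≤ δ < 1 and d ≥ 2. For
t ≥ 1 one has |u| ≲ t^{-(d/4-δ/2)} ‖G‖₂, which lies in L^q in time when δ < d/2 - 2/q. -/

/-! ### Plancherel's theorem on L¹ ∩ L². -/

theorem lintegral_enorm_sq_eq_eLpNorm_sq {α E : Type*} [MeasurableSpace α] [NormedAddCommGroup E]
    {μ : Measure α} (f : α → E) : ∫⁻ x, ‖f x‖ₑ ^ 2 ∂μ = eLpNorm f 2 μ ^ 2 := by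
  have h := eLpNorm_nnreal_pow_eq_lintegral (f := f) (μ := μ) (p := 2) two_ne_zero
  simp only [NNReal.coe_ofNat, ENNReal.coe_ofNat, ENNReal.rpow_ofNat] at h
  exact h.symm

theorem memLp_two_of_lintegral {α E : Type*} [MeasurableSpace α] [NormedAddCommGroup E]
    {μ : Measure α} {f : α → E} (hf : AEStronglyMeasurable f μ)
    (h : ∫⁻ x, ‖f x‖ₑ ^ 2 ∂μ < ∞) : MemLp f 2 μ := by
  refine ⟨hf, ?_⟩
  rw [lintegral_enorm_sq_eq_eLpNorm_sq] at h
  by_contra hc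
  simp only [not_lt, top_le_iff] at hc
  simp [hc] at h

/-- The Fourier integral of a function in `L¹ ∩ L²` represents its `L²` Fourier transform. -/
theorem coeFn_fourier_toLp_ae_eq {V : Type*} [NormedAddCommGroup V] [InnerProductSpace ℝ V]
    [FiniteDimensional ℝ V] [MeasurableSpace V] [BorelSpace V] {h : V → ℂ}
    (h1 : Integrable h) (h2 : MemLp h 2) :
    ((𝓕 (h2.toLp h) : Lp ℂ 2 (volume : Measure V)) : V → ℂ) =ᵐ[volume] 𝓕 h := by
  have hcont : Continuous (𝓕 h) :=
    VectorFourier.fourierIntegral_continuous Real.continuous_fourierChar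
      (by exact continuous_inner) h1
  -- Both sides are locally integrable, so it suffices to test against smooth compactly supported
  -- functions. There the L² transform is computed as a tempered distribution and the integral one
  -- by moving 𝓕 across the pairing.
  refine ae_eq_of_integral_contDiff_smul_eq
    ((Lp.memLp _).locallyIntegrable (by norm_num)) hcont.locallyIntegrable fun g hg hgc => ?_
  set φ : 𝓢(V, ℂ) := HasCompactSupport.toSchwartzMap (f := fun x => (g x : ℂ))
    (hgc.comp_left (g := fun r : ℝ => (r : ℂ)) (by simp))
    (Complex.ofRealCLM.contDiff.comp hg) with hφ
  have e1 := congrArg (fun T : 𝓢'(V, ℂ) => T φ) (Lp.fourier_toTemperedDistribution_eq (h2.toLp h))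
  simp only [TemperedDistribution.fourier_apply, Lp.toTemperedDistribution_apply] at e1
  have e2 : ∫ x, φ x • (𝓕 (h2.toLp h) : Lp ℂ 2 (volume : Measure V)) x = ∫ x, 𝓕 φ x • h x := by
    rw [← e1]
    refine integral_congr_ae ?_
    filter_upwards [h2.coeFn_toLp] with x hx
    rw [hx]
  have e3 := VectorFourier.integral_fourierIntegral_smul_eq_flip (L := innerₗ V)
    (μ := volume) (ν := volume) (f := (φ : V → ℂ)) (g := h)
    Real.continuous_fourierChar continuous_inner φ.integrable h1
  have e4 : ∫ x, 𝓕 φ x • h x = ∫ x, φ x • 𝓕 h x := by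
    rw [flip_innerₗ] at e3
    exact e3
  rw [e4] at e2
  exact e2

/-- Plancherel's theorem for functions in `L¹ ∩ L²`. -/
theorem lintegral_enorm_sq_fourier {V : Type*} [NormedAddCommGroup V] [InnerProductSpace ℝ V]
    [FiniteDimensional ℝ V] [MeasurableSpace V] [BorelSpace V] {h : V → ℂ}
    (h1 : Integrable h) (h2 : MemLp h 2) :
    ∫⁻ x, ‖𝓕 h x‖ₑ ^ 2 = ∫⁻ x, ‖h x‖ₑ ^ 2 := by
  rw [lintegral_enorm_sq_eq_eLpNorm_sq, lintegral_enorm_sq_eq_eLpNorm_sq,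
    ← eLpNorm_congr_ae (coeFn_fourier_toLp_ae_eq h1 h2), ← Lp.enorm_def]
  have : ‖(𝓕 (h2.toLp h) : Lp ℂ 2 (volume : Measure V))‖ₑ = ‖h2.toLp h‖ₑ := by
    rw [← ofReal_norm, ← ofReal_norm, Lp.norm_fourier_eq]
  rw [this, Lp.enorm_toLp]

/-! ### The heat multiplier in L² and L¹. -/

theorem rpow_mul_exp_neg_le {b : ℝ} (hb : 0 < b) {y : ℝ} (hy : 0 ≤ y) :
    y ^ b * Real.exp (-y) ≤ b ^ b := by
  have h1 : y ≤ b * Real.exp (y / b) := by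
    have := Real.add_one_le_exp (y / b)
    have h2 : y = b * (y / b) := by field_simp
    nlinarith
  have h3 : y ^ b ≤ b ^ b * Real.exp y := by
    calc y ^ b ≤ (b * Real.exp (y / b)) ^ b := by gcongr
      _ = b ^ b * Real.exp y := by
        rw [Real.mul_rpow hb.le (Real.exp_pos _).le, ← Real.exp_mul]
        congr 2; field_simp
  calc y ^ b * Real.exp (-y) ≤ b ^ b * Real.exp y * Real.exp (-y) := by gcongr
    _ = b ^ b := by rw [mul_assoc, ← Real.exp_add]; simp

/-- `sup_ρ ρ^a e^{-tρ²} ≲ t^{-a/2}`. -/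
theorem rpow_mul_exp_neg_mul_sq_le {a : ℝ} (ha : 0 < a) {t r : ℝ} (ht : 0 < t) (hr : 0 ≤ r) :
    r ^ a * Real.exp (-(t * r ^ 2)) ≤ (a / 2) ^ (a / 2) * t ^ (-(a / 2)) := by
  have h := rpow_mul_exp_neg_le (half_pos ha) (y := t * r ^ 2) (by positivity)
  rw [Real.mul_rpow ht.le (by positivity), ← Real.rpow_natCast_mul hr] at h
  have e : ((2 : ℕ) : ℝ) * (a / 2) = a := by push_cast; ring
  rw [e] at h
  have h3 : t ^ (-(a / 2)) * t ^ (a / 2) = 1 := by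
    rw [← Real.rpow_add ht]; simp
  calc r ^ a * Real.exp (-(t * r ^ 2))
      = t ^ (-(a / 2)) * t ^ (a / 2) * (r ^ a * Real.exp (-(t * r ^ 2))) := by rw [h3, one_mul]
    _ = (t ^ (a / 2) * r ^ a * Real.exp (-(t * r ^ 2))) * t ^ (-(a / 2)) := by ring
    _ ≤ _ := by gcongr

/-- The function `ξ ↦ (2π|ξ|)^a e^{-t(2π|ξ|)²} G(ξ)`. -/
def heatSymbol {d : ℕ} (a t : ℝ) (G : EuclideanSpace ℝ (Fin d) → ℂ)
    (ξ : EuclideanSpace ℝ (Fin d)) : ℂ :=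
  (((2 * Real.pi * ‖ξ‖) ^ a * Real.exp (-(t * (2 * Real.pi * ‖ξ‖) ^ 2)) : ℝ) : ℂ) * G ξ

theorem enorm_heatSymbol {d : ℕ} (a t : ℝ) (G : EuclideanSpace ℝ (Fin d) → ℂ)
    (ξ : EuclideanSpace ℝ (Fin d)) : ‖heatSymbol a t G ξ‖ₑ =
      ENNReal.ofReal ((2 * Real.pi * ‖ξ‖) ^ a * Real.exp (-(t * (2 * Real.pi * ‖ξ‖) ^ 2)))
        * ‖G ξ‖ₑ := by
  rw [heatSymbol, enorm_mul, ← ofReal_norm, Complex.norm_real, Real.norm_of_nonneg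
    (by positivity)]

theorem norm_heatSymbol {d : ℕ} (a t : ℝ) (G : EuclideanSpace ℝ (Fin d) → ℂ)
    (ξ : EuclideanSpace ℝ (Fin d)) : ‖heatSymbol a t G ξ‖ =
      (2 * Real.pi * ‖ξ‖) ^ a * Real.exp (-(t * (2 * Real.pi * ‖ξ‖) ^ 2)) * ‖G ξ‖ := by
  rw [heatSymbol, norm_mul, Complex.norm_real, Real.norm_of_nonneg (by positivity)]

theorem aestronglyMeasurable_heatSymbol {d : ℕ} (a t : ℝ) {G : EuclideanSpace ℝ (Fin d) → ℂ}
    (hG : AEStronglyMeasurable G) : AEStronglyMeasurable (heatSymbol a t G) := by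
  refine AEStronglyMeasurable.mul (Measurable.aestronglyMeasurable ?_) hG
  fun_prop

theorem lintegral_exp_neg_mul_norm_sq (d : ℕ) : ∃ C : ℝ, 0 < C ∧ ∀ t : ℝ, 0 < t →
    ∫⁻ ξ : EuclideanSpace ℝ (Fin d), ENNReal.ofReal (Real.exp (-(t * (2 * Real.pi * ‖ξ‖) ^ 2)))
      = ENNReal.ofReal (C * t ^ (-((d : ℝ) / 2))) := by
  refine ⟨(4 * Real.pi) ^ (-((d : ℝ) / 2)), by positivity, fun t ht => ?_⟩
  have hb : 0 < t * (2 * Real.pi) ^ 2 := by positivity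
  have h := GaussianFourier.integral_rexp_neg_mul_sq_norm (V := EuclideanSpace ℝ (Fin d)) hb
  have he : ∀ ξ : EuclideanSpace ℝ (Fin d), -(t * (2 * Real.pi * ‖ξ‖) ^ 2)
      = -(t * (2 * Real.pi) ^ 2) * ‖ξ‖ ^ 2 := fun ξ => by ring
  simp_rw [he]
  rw [← ofReal_integral_eq_lintegral_ofReal, h]
  · congr 1
    rw [finrank_euclideanSpace_fin, ← Real.mul_rpow (by positivity) ht.le,
      Real.rpow_neg (by positivity), ← Real.inv_rpow (by positivity)]
    congr 1
    field_simp
    ring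
  -- The Bochner integral of a non-integrable function is 0, while the Gaussian integral is
  -- positive; integrability comes for free.
  · by_contra hc
    rw [integral_undef hc] at h
    have : 0 < (Real.pi / (t * (2 * Real.pi) ^ 2)) ^
        ((Module.finrank ℝ (EuclideanSpace ℝ (Fin d)) : ℝ) / 2) := by positivity
    linarith
  · exact Filter.Eventually.of_forall fun _ => (Real.exp_pos _).le

/-- `‖ρ^a e^{-tρ²} G‖_{L²} ≲ t^{-a/2} ‖G‖_{L²}`. -/
theorem lintegral_heatSymbol_sq_le {a : ℝ} (ha : 0 < a) : ∃ C : ℝ, 0 < C ∧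
    ∀ (d : ℕ) (G : EuclideanSpace ℝ (Fin d) → ℂ) (t : ℝ), 0 < t →
      ∫⁻ ξ, ‖heatSymbol a t G ξ‖ₑ ^ 2 ≤ ENNReal.ofReal (C * t ^ (-a)) * ∫⁻ ξ, ‖G ξ‖ₑ ^ 2 := by
  refine ⟨((a / 2) ^ (a / 2)) ^ 2, by positivity, fun d G t ht => ?_⟩
  rw [← lintegral_const_mul' _ _ ENNReal.ofReal_ne_top]
  refine lintegral_mono fun ξ => ?_
  rw [enorm_heatSymbol, mul_pow, ← ENNReal.ofReal_pow (by positivity)]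
  gcongr
  calc _ ≤ ((a / 2) ^ (a / 2) * t ^ (-(a / 2))) ^ 2 := by
        exact pow_le_pow_left₀ (by positivity)
          (rpow_mul_exp_neg_mul_sq_le ha ht (by positivity)) 2
    _ = _ := by
        rw [mul_pow, ← Real.rpow_mul_natCast ht.le]; congr 2; push_cast; ring

/-- `‖ρ^a e^{-tρ²} G‖_{L¹} ≲ t^{-a/2-d/4} ‖G‖_{L²}`. -/
theorem lintegral_heatSymbol_le {a : ℝ} (ha : 0 < a) (d : ℕ) : ∃ C : ℝ, 0 < C ∧
    ∀ (G : EuclideanSpace ℝ (Fin d) → ℂ) (t : ℝ), 0 < t → AEStronglyMeasurable G →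
      ∫⁻ ξ, ‖heatSymbol a t G ξ‖ₑ ≤ ENNReal.ofReal (C * t ^ (-(a / 2) - (d : ℝ) / 4)) *
        eLpNorm G 2 := by
  obtain ⟨C₁, hC₁, h₁⟩ := lintegral_exp_neg_mul_norm_sq d
  obtain ⟨C₂, hC₂, h₂⟩ := lintegral_heatSymbol_sq_le ha
  refine ⟨(C₁ ^ (1 / 2 : ℝ)) * (C₂ * 2 ^ a) ^ (1 / 2 : ℝ), by positivity, fun G t ht hG => ?_⟩
  -- Half of the Gaussian goes to each factor of Cauchy–Schwarz: the pure Gaussian gives t^{-d/4},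
  -- and the symbol at time t/2 gives t^{-a/2} from the L² bound. The 2^a in the constant comes from
  -- t/2.
  have e : ∀ ξ : EuclideanSpace ℝ (Fin d), ‖heatSymbol a t G ξ‖ₑ =
      ENNReal.ofReal (Real.exp (-(t / 2 * (2 * Real.pi * ‖ξ‖) ^ 2))) *
        ‖heatSymbol a (t / 2) G ξ‖ₑ := fun ξ => by
    rw [enorm_heatSymbol, enorm_heatSymbol, ← mul_assoc, ← ENNReal.ofReal_mul (by positivity)]
    congr 2
    rw [mul_left_comm, ← Real.exp_add]
    congr 2; ring
  simp_rw [e]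
  have hh := ENNReal.lintegral_mul_le_Lp_mul_Lq volume Real.HolderConjugate.two_two
    (f := fun ξ : EuclideanSpace ℝ (Fin d) =>
      ENNReal.ofReal (Real.exp (-(t / 2 * (2 * Real.pi * ‖ξ‖) ^ 2))))
    (g := fun ξ => ‖heatSymbol a (t / 2) G ξ‖ₑ) (by fun_prop)
    (aestronglyMeasurable_heatSymbol a (t / 2) hG).enorm
  simp only [Pi.mul_apply, ENNReal.rpow_two] at hh
  refine hh.trans ?_
  have e2 : ∀ ξ : EuclideanSpace ℝ (Fin d),
      ENNReal.ofReal (Real.exp (-(t / 2 * (2 * Real.pi * ‖ξ‖) ^ 2))) ^ 2 =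
      ENNReal.ofReal (Real.exp (-(t * (2 * Real.pi * ‖ξ‖) ^ 2))) := fun ξ => by
    rw [← ENNReal.ofReal_pow (by positivity), ← Real.exp_nat_mul]
    congr 2; push_cast; ring
  simp_rw [e2]
  rw [h₁ t ht]
  calc _ ≤ ENNReal.ofReal (C₁ * t ^ (-((d : ℝ) / 2))) ^ (1 / 2 : ℝ) *
        (ENNReal.ofReal (C₂ * (t / 2) ^ (-a)) * eLpNorm G 2 ^ 2) ^ (1 / 2 : ℝ) := by
        gcongr
        rw [← lintegral_enorm_sq_eq_eLpNorm_sq]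
        exact h₂ d G (t / 2) (by positivity)
    _ = _ := by
        rw [ENNReal.mul_rpow_of_nonneg _ _ (by norm_num), ← mul_assoc,
          ENNReal.ofReal_rpow_of_nonneg (by positivity) (by norm_num),
          ENNReal.ofReal_rpow_of_nonneg (by positivity) (by norm_num),
          ← ENNReal.ofReal_mul (by positivity)]
        congr 1
        · congr 1
          have : (t / 2) ^ (-a) = 2 ^ a * t ^ (-a) := by
            rw [Real.div_rpow ht.le (by norm_num), Real.rpow_neg (by norm_num : (0:ℝ) ≤ 2)]
            field_simp
          rw [this, ← mul_assoc, Real.mul_rpow (by positivity) (by positivity),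
            Real.mul_rpow (by positivity) (by positivity), ← Real.rpow_mul ht.le,
            ← Real.rpow_mul ht.le, show -(a / 2) - (d : ℝ) / 4 =
              -((d : ℝ) / 2) * (1 / 2) + -a * (1 / 2) by ring, Real.rpow_add ht]
          ring
        · rw [← ENNReal.rpow_two, ← ENNReal.rpow_mul]; norm_num

/-! ### Radial functions and the radial Sobolev inequality. -/

/-- The fundamental theorem of calculus on a half-line. Integrability of the derivative need not be
assumed, because the bound is trivial when the right side is infinite. -/
theorem enorm_le_lintegral_Ioi_of_hasDerivAt {E : Type*} [NormedAddCommGroup E] [NormedSpace ℝ E]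
    [CompleteSpace E] {f f' : ℝ → E} {r : ℝ} (hf : ∀ s ∈ Ici r, HasDerivAt f (f' s) s)
    (hm : AEStronglyMeasurable f' (volume.restrict (Ioi r)))
    (h0 : Filter.Tendsto f Filter.atTop (nhds 0)) :
    ‖f r‖ₑ ≤ ∫⁻ s in Ioi r, ‖f' s‖ₑ := by
  by_cases hfin : ∫⁻ s in Ioi r, ‖f' s‖ₑ = ∞
  · simp [hfin]
  · have hi : IntegrableOn f' (Ioi r) := ⟨hm, lt_top_iff_ne_top.2 hfin⟩
    have := integral_Ioi_of_hasDerivAt_of_tendsto' hf hi h0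
    rw [zero_sub] at this
    rw [← enorm_neg, ← this]
    exact enorm_integral_le_lintegral_enorm _

/-- Polar coordinates in `[0, ∞]`, so that no integrability has to be checked when they are used. -/
theorem lintegral_fun_norm_addHaar {E : Type*} [NormedAddCommGroup E] [NormedSpace ℝ E]
    [Nontrivial E] [FiniteDimensional ℝ E] [MeasurableSpace E] [BorelSpace E] (μ : Measure E)
    [μ.IsAddHaarMeasure] {f : ℝ → ℝ≥0∞} (hf : Measurable f) :
    ∫⁻ x, f ‖x‖ ∂μ = μ.toSphere univ *
      ∫⁻ y in Ioi (0 : ℝ), ENNReal.ofReal (y ^ (Module.finrank ℝ E - 1)) * f y := by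
  calc ∫⁻ x, f ‖x‖ ∂μ = ∫⁻ x : ({(0)}ᶜ : Set E), f (‖x.1‖) ∂(μ.comap (↑)) := by
        rw [lintegral_subtype_comap (measurableSet_singleton _).compl fun x ↦ f (‖x‖),
          restrict_compl_singleton]
    _ = ∫⁻ x, f x.2 ∂μ.toSphere.prod (.volumeIoiPow (Module.finrank ℝ E - 1)) := by
        have := μ.measurePreserving_homeomorphUnitSphereProd.lintegral_comp_emb
          (Homeomorph.measurableEmbedding _) (f ∘ Subtype.val ∘ Prod.snd)
        simpa using this
    _ = μ.toSphere univ * ∫⁻ x : Ioi (0 : ℝ), f x ∂.volumeIoiPow (Module.finrank ℝ E - 1) := by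
        rw [lintegral_prod _ (by fun_prop)]
        simp [mul_comm]
    _ = _ := by
        rw [Measure.volumeIoiPow, lintegral_withDensity_eq_lintegral_mul _ (by fun_prop)
          (by fun_prop)]
        congr 1
        exact lintegral_subtype_comap measurableSet_Ioi
          fun x ↦ ENNReal.ofReal (x ^ (Module.finrank ℝ E - 1)) * f x

/-- A function on a Euclidean space which is invariant under all linear isometries. -/
def IsRadialFun {d : ℕ} {E : Type*} (w : EuclideanSpace ℝ (Fin d) → E) : Prop :=
  ∀ (A : EuclideanSpace ℝ (Fin d) ≃ₗᵢ[ℝ] EuclideanSpace ℝ (Fin d)) (x), w (A x) = w x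

/-- The reflection in the hyperplane orthogonal to x - y exchanges two vectors of equal length. -/
theorem IsRadialFun.eq_of_norm_eq {d : ℕ} {E : Type*} {w : EuclideanSpace ℝ (Fin d) → E}
    (hw : IsRadialFun w) {x y : EuclideanSpace ℝ (Fin d)} (h : ‖x‖ = ‖y‖) : w x = w y := by
  rw [← hw (Submodule.reflection (Submodule.span ℝ {x - y})ᗮ) x]
  congr 1
  exact Submodule.reflection_sub h

/-- The radial Sobolev inequality `|w(x)|² ≲ ‖w‖_{L²} ‖∇w‖_{L²}` away from the origin. -/
theorem radial_sobolev {d : ℕ} (hd : 1 ≤ d) : ∃ C : ℝ≥0, 0 < C ∧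
    ∀ w : EuclideanSpace ℝ (Fin d) → ℂ, ContDiff ℝ 1 w → IsRadialFun w →
      Filter.Tendsto w (Filter.cocompact _) (nhds 0) →
      ∀ x, 1 / 2 ≤ ‖x‖ → ‖w x‖ₑ ^ 2 ≤ C * (eLpNorm w 2 * eLpNorm (fderiv ℝ w) 2) := by
  have : Nonempty (Fin d) := ⟨⟨0, hd⟩⟩
  set V := EuclideanSpace ℝ (Fin d) with hV
  set σ : ℝ≥0∞ := (volume : Measure V).toSphere univ with hσ
  have hσ0 : σ ≠ 0 := by
    rw [hσ, Ne, Measure.measure_univ_eq_zero]; exact Measure.toSphere_ne_zero _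
  have hσt : σ ≠ ∞ := measure_ne_top _ _
  -- The first 2 comes from differentiating |W|², 2^{d-1} from inserting s^{d-1} ≥ 2^{-(d-1)} for s
  -- ≥ 1/2, and the inverse sphere measure from polar coordinates.
  refine ⟨2 * 2 ^ (d - 1) * σ.toNNReal⁻¹, by
    have : 0 < σ.toNNReal := ENNReal.toNNReal_pos hσ0 hσt
    positivity, fun w hw hr h0 x hx => ?_⟩
  obtain ⟨e, he⟩ : ∃ e : V, ‖e‖ = 1 := exists_norm_eq V zero_le_one
  have hdiff : Differentiable ℝ w := hw.differentiable one_ne_zero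
  set W : ℝ → ℂ := fun s => w (s • e) with hWdef
  set W' : ℝ → ℂ := fun s => fderiv ℝ w (s • e) e with hW'def
  have hW : ∀ s, HasDerivAt W (W' s) s := fun s => by
    have h1 : HasDerivAt (fun s : ℝ => s • e) e s := by
      simpa using (hasDerivAt_id s).smul_const e
    exact (hdiff (s • e)).hasFDerivAt.comp_hasDerivAt s h1
  have hW'c : Continuous W' :=
    ((hw.continuous_fderiv one_ne_zero).comp (continuous_id.smul continuous_const)).clm_apply
      continuous_const
  have hWc : Continuous W := continuous_iff_continuousAt.2 fun s => (hW s).continuousAt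
  have hw_eq : ∀ y, w y = W ‖y‖ := fun y => hr.eq_of_norm_eq (by simp [norm_smul, he])
  -- By radiality the profile W can be read along the ray through y instead of through e, so W'(|y|)
  -- is the derivative of w at y in the unit direction y/|y|.
  have hw'_le : ∀ y, y ≠ 0 → ‖W' ‖y‖‖ₑ ≤ ‖fderiv ℝ w y‖ₑ := fun y hy => by
    have hy' : 0 < ‖y‖ := norm_pos_iff.2 hy
    have h1 : HasDerivAt (fun s : ℝ => s • (‖y‖⁻¹ • y)) (‖y‖⁻¹ • y) ‖y‖ := by
      simpa using (hasDerivAt_id ‖y‖).smul_const (‖y‖⁻¹ • y)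
    have hpt : ‖y‖ • (‖y‖⁻¹ • y) = y := by rw [smul_smul, mul_inv_cancel₀ hy'.ne', one_smul]
    have hz : HasFDerivAt w (fderiv ℝ w y) (‖y‖ • (‖y‖⁻¹ • y)) := by
      rw [hpt]; exact (hdiff y).hasFDerivAt
    have h2 := hz.comp_hasDerivAt ‖y‖ h1
    have h3 : w ∘ (fun s : ℝ => s • (‖y‖⁻¹ • y)) = W := by
      funext s
      refine hr.eq_of_norm_eq ?_
      rw [norm_smul, norm_smul, norm_smul, he, norm_inv, norm_norm, inv_mul_cancel₀ hy'.ne']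
    rw [h3] at h2
    rw [(hW ‖y‖).unique h2]
    refine (ContinuousLinearMap.le_opENorm _ _).trans ?_
    have : ‖‖y‖⁻¹ • y‖ₑ = 1 := by
      rw [← ofReal_norm, norm_smul, norm_inv, norm_norm, inv_mul_cancel₀ hy'.ne',
        ENNReal.ofReal_one]
    rw [this, mul_one]
  have hatTop : Filter.Tendsto W Filter.atTop (nhds 0) := by
    refine h0.comp ?_
    rw [← Metric.cobounded_eq_cocompact, ← tendsto_norm_atTop_iff_cobounded]
    have : (fun s : ℝ => ‖s • e‖) = fun s => |s| := by
      funext s; rw [norm_smul, he, mul_one, Real.norm_eq_abs]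
    rw [this]
    exact Filter.tendsto_abs_atTop_atTop
  have hder : ∀ s ∈ Ici ‖x‖, HasDerivAt (fun s => ‖W s‖ ^ 2) (2 * inner ℝ (W s) (W' s)) s :=
    fun s _ => (hW s).norm_sq
  have hto : Filter.Tendsto (fun s => ‖W s‖ ^ 2) Filter.atTop (nhds 0) := by
    simpa using (hatTop.norm.pow 2)
  -- |W(r)|² is minus the integral of (|W|²)' over (r, ∞). After the weight s^{d-1} is inserted this
  -- is an integral over space, to which Cauchy–Schwarz applies.
  have h1 := enorm_le_lintegral_Ioi_of_hasDerivAt hder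
    (Continuous.aestronglyMeasurable (by fun_prop)) hto
  have h2 : ∀ s ∈ Ioi ‖x‖, ‖2 * inner ℝ (W s) (W' s)‖ₑ ≤
      (2 * 2 ^ (d - 1)) * (ENNReal.ofReal (s ^ (d - 1)) * (‖W s‖ₑ * ‖W' s‖ₑ)) := fun s hs => by
    have hs' : 1 / 2 ≤ s := hx.trans (le_of_lt hs)
    have h3 : ‖inner ℝ (W s) (W' s)‖ₑ ≤ ‖W s‖ₑ * ‖W' s‖ₑ := by
      rw [← ofReal_norm, ← ofReal_norm, ← ofReal_norm, ← ENNReal.ofReal_mul (norm_nonneg _)]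
      exact ENNReal.ofReal_le_ofReal (norm_inner_le_norm _ _)
    have h4 : (1 : ℝ≥0∞) ≤ 2 ^ (d - 1) * ENNReal.ofReal (s ^ (d - 1)) := by
      have : (2 : ℝ≥0∞) ^ (d - 1) = ENNReal.ofReal (2 ^ (d - 1)) := by
        rw [ENNReal.ofReal_pow (by norm_num)]; simp
      rw [this, ← ENNReal.ofReal_mul (by positivity), ← mul_pow, ENNReal.one_le_ofReal]
      exact one_le_pow₀ (by linarith)
    calc ‖2 * inner ℝ (W s) (W' s)‖ₑ = 2 * ‖inner ℝ (W s) (W' s)‖ₑ := by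
          rw [enorm_mul]; congr 1; rw [← ofReal_norm]; simp
      _ ≤ 2 * (1 * (‖W s‖ₑ * ‖W' s‖ₑ)) := by rw [one_mul]; gcongr
      _ ≤ 2 * ((2 ^ (d - 1) * ENNReal.ofReal (s ^ (d - 1))) * (‖W s‖ₑ * ‖W' s‖ₑ)) := by gcongr
      _ = _ := by ring
  have h5 : ∫⁻ y, ‖W ‖y‖‖ₑ * ‖W' ‖y‖‖ₑ ∂(volume : Measure V) = σ *
      ∫⁻ y in Ioi (0 : ℝ), ENNReal.ofReal (y ^ (d - 1)) * (‖W y‖ₑ * ‖W' y‖ₑ) := by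
    have := lintegral_fun_norm_addHaar (volume : Measure V) (f := fun s => ‖W s‖ₑ * ‖W' s‖ₑ)
      (by fun_prop)
    have hfr : Module.finrank ℝ V = d := finrank_euclideanSpace_fin
    rwa [hfr] at this
  have h6 : ∫⁻ y in Ioi (0 : ℝ), ENNReal.ofReal (y ^ (d - 1)) * (‖W y‖ₑ * ‖W' y‖ₑ) = σ⁻¹ *
      ∫⁻ y, ‖W ‖y‖‖ₑ * ‖W' ‖y‖‖ₑ ∂(volume : Measure V) := by
    rw [h5, ← mul_assoc, ENNReal.inv_mul_cancel hσ0 hσt, one_mul]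
  have h7 : ∫⁻ y, ‖W ‖y‖‖ₑ * ‖W' ‖y‖‖ₑ ∂(volume : Measure V) ≤
      eLpNorm w 2 * eLpNorm (fderiv ℝ w) 2 := by
    calc _ ≤ ∫⁻ y, ‖w y‖ₑ * ‖fderiv ℝ w y‖ₑ ∂(volume : Measure V) := by
          refine lintegral_mono_ae ?_
          filter_upwards [compl_mem_ae_iff.2 (measure_singleton (μ := volume) (0 : V))] with y hy
          rw [hw_eq y]
          gcongr
          exact hw'_le y hy
      _ ≤ _ := by
          have := ENNReal.lintegral_mul_le_Lp_mul_Lq (volume : Measure V)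
            Real.HolderConjugate.two_two (f := fun y => ‖w y‖ₑ) (g := fun y => ‖fderiv ℝ w y‖ₑ)
            (by exact hw.continuous.enorm.aemeasurable)
            (by exact (hw.continuous_fderiv one_ne_zero).enorm.aemeasurable)
          simp only [Pi.mul_apply] at this
          refine this.trans (le_of_eq ?_)
          rw [eLpNorm_eq_lintegral_rpow_enorm_toReal (by norm_num) (by norm_num),
            eLpNorm_eq_lintegral_rpow_enorm_toReal (by norm_num) (by norm_num)]
          simp
          rfl
  calc ‖w x‖ₑ ^ 2 = ‖‖W ‖x‖‖ ^ 2‖ₑ := by rw [hw_eq x, enorm_pow, enorm_norm]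
    _ ≤ ∫⁻ s in Ioi ‖x‖, ‖2 * inner ℝ (W s) (W' s)‖ₑ := h1
    _ ≤ ∫⁻ s in Ioi ‖x‖, (2 * 2 ^ (d - 1)) *
        (ENNReal.ofReal (s ^ (d - 1)) * (‖W s‖ₑ * ‖W' s‖ₑ)) :=
        setLIntegral_mono' measurableSet_Ioi h2
    _ ≤ ∫⁻ s in Ioi 0, (2 * 2 ^ (d - 1)) *
        (ENNReal.ofReal (s ^ (d - 1)) * (‖W s‖ₑ * ‖W' s‖ₑ)) :=
        lintegral_mono_set (Ioi_subset_Ioi (norm_nonneg _))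
    _ = (2 * 2 ^ (d - 1)) * (σ⁻¹ * ∫⁻ y, ‖W ‖y‖‖ₑ * ‖W' ‖y‖‖ₑ ∂(volume : Measure V)) := by
        rw [lintegral_const_mul' _ _ (by finiteness), h6]
    _ ≤ (2 * 2 ^ (d - 1)) * (σ⁻¹ * (eLpNorm w 2 * eLpNorm (fderiv ℝ w) 2)) := by gcongr
    _ = _ := by
        rw [← mul_assoc]
        congr 1
        rw [ENNReal.coe_mul, ENNReal.coe_inv (ENNReal.toNNReal_pos hσ0 hσt).ne',
          ENNReal.coe_toNNReal hσt]
        push_cast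
        rfl

/-! ### Hardy's inequality. -/

theorem lintegral_Ioi_rpow_neg {b : ℝ} (hb : 0 < b) {t : ℝ} (ht : 0 < t) :
    ∫⁻ s in Ioi t, ENNReal.ofReal (s ^ (-1 - b)) = ENNReal.ofReal (t ^ (-b) / b) := by
  rw [← ofReal_integral_eq_lintegral_ofReal (integrableOn_Ioi_rpow_of_lt (by linarith) ht)]
  · rw [integral_Ioi_rpow_of_lt (by linarith) ht]
    congr 1
    rw [show -1 - b + 1 = -b by ring, neg_div_neg_eq]
  · filter_upwards [ae_restrict_mem measurableSet_Ioi] with s hs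
    exact Real.rpow_nonneg (ht.trans hs).le _

theorem lintegral_Ioo_rpow {b : ℝ} (hb : 0 < b) {s : ℝ} (hs : 0 < s) :
    ∫⁻ t in Ioo 0 s, ENNReal.ofReal (t ^ (b - 1)) = ENNReal.ofReal (s ^ b / b) := by
  have hi : IntervalIntegrable (fun t : ℝ => t ^ (b - 1)) volume 0 s :=
    intervalIntegral.intervalIntegrable_rpow' (by linarith)
  have hi' : IntegrableOn (fun t : ℝ => t ^ (b - 1)) (Ioo 0 s) :=
    ((intervalIntegrable_iff_integrableOn_Ioc_of_le hs.le).1 hi).mono_set Ioo_subset_Ioc_self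
  rw [← ofReal_integral_eq_lintegral_ofReal hi', ← integral_Ioc_eq_integral_Ioo,
    ← intervalIntegral.integral_of_le hs.le, integral_rpow (Or.inl (by linarith))]
  · rw [show b - 1 + 1 = b by ring, Real.zero_rpow hb.ne', sub_zero]
  · filter_upwards [ae_restrict_mem measurableSet_Ioo] with t ht
    exact Real.rpow_nonneg ht.1.le _

/-- Hardy's inequality in the form `∫ (∫_t^∞ V)^q dt ≲ ∫ s^q V(s)^q ds`. -/
theorem hardy_inequality {q : ℝ} (hq : 1 < q) : ∃ C : ℝ≥0, ∀ U V : ℝ → ℝ≥0∞, Measurable V →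
    (∀ t, 0 < t → U t ≤ ∫⁻ s in Ioi t, V s) →
    ∫⁻ t in Ioi 0, U t ^ q ≤ C * ∫⁻ s in Ioi 0, ENNReal.ofReal (s ^ q) * V s ^ q := by
  have hq0 : 0 < q := by linarith
  obtain ⟨p, hp⟩ : ∃ p : ℝ, p.HolderConjugate q := ⟨_, (Real.HolderConjugate.conjExponent hq).symm⟩
  have hp0 : 0 < p := hp.pos
  have hpq : q / p = q - 1 := hp.symm.div_conj_eq_sub_one
  -- Hölder is applied to s^{-θ} · s^θ V. This b makes s^{-θp} = s^{-1-b} integrable at infinity and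
  -- leaves the weight t^{-1/2} outside and s^{q-1/2} inside; any small enough b > 0 would serve.
  set b : ℝ := p / (2 * q) with hb
  have hb0 : 0 < b := by positivity
  set θ : ℝ := (1 + b) / p with hθ
  have hθq : θ * q = q - 1 / 2 := by
    have : θ * q = q / p + 1 / 2 := by rw [hθ, hb]; field_simp
    rw [this, hpq]; ring
  have hbq : -b * (1 / p) * q = -(1 / 2) := by rw [hb]; field_simp
  refine ⟨((1 / b) ^ (1 / p * q) * 2).toNNReal, fun U V hV hUV => ?_⟩
  have step : ∀ t, 0 < t → U t ^ q ≤ ENNReal.ofReal ((1 / b) ^ (1 / p * q) * t ^ (-(1 / 2) : ℝ)) *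
      ∫⁻ s in Ioi t, ENNReal.ofReal (s ^ (q - 1 / 2)) * V s ^ q := fun t ht => by
    have h1 : ∫⁻ s in Ioi t, V s =
        ∫⁻ s in Ioi t, ENNReal.ofReal (s ^ (-θ)) * (ENNReal.ofReal (s ^ θ) * V s) := by
      refine setLIntegral_congr_fun measurableSet_Ioi fun s hs => ?_
      have hs0 : 0 < s := ht.trans hs
      rw [← mul_assoc, ← ENNReal.ofReal_mul (by positivity), ← Real.rpow_add hs0]
      simp
    have h2 := ENNReal.lintegral_mul_le_Lp_mul_Lq (volume.restrict (Ioi t)) hp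
      (f := fun s => ENNReal.ofReal (s ^ (-θ))) (g := fun s => ENNReal.ofReal (s ^ θ) * V s)
      (by fun_prop) (by fun_prop)
    simp only [Pi.mul_apply] at h2
    have h3 : ∫⁻ s in Ioi t, ENNReal.ofReal (s ^ (-θ)) ^ p = ENNReal.ofReal (t ^ (-b) / b) := by
      rw [← lintegral_Ioi_rpow_neg hb0 ht]
      refine setLIntegral_congr_fun measurableSet_Ioi fun s hs => ?_
      have hs0 : 0 < s := ht.trans hs
      rw [ENNReal.ofReal_rpow_of_nonneg (by positivity) hp0.le, ← Real.rpow_mul hs0.le]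
      congr 2
      rw [hθ]; field_simp; ring
    have h4 : ∫⁻ s in Ioi t, (ENNReal.ofReal (s ^ θ) * V s) ^ q =
        ∫⁻ s in Ioi t, ENNReal.ofReal (s ^ (q - 1 / 2)) * V s ^ q := by
      refine setLIntegral_congr_fun measurableSet_Ioi fun s hs => ?_
      have hs0 : 0 < s := ht.trans hs
      rw [ENNReal.mul_rpow_of_nonneg _ _ hq0.le,
        ENNReal.ofReal_rpow_of_nonneg (by positivity) hq0.le, ← Real.rpow_mul hs0.le, hθq]
    rw [h3, h4, ← h1] at h2
    calc U t ^ q ≤ (ENNReal.ofReal (t ^ (-b) / b) ^ (1 / p) *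
          (∫⁻ s in Ioi t, ENNReal.ofReal (s ^ (q - 1 / 2)) * V s ^ q) ^ (1 / q)) ^ q := by
          gcongr; exact (hUV t ht).trans h2
      _ = _ := by
          rw [ENNReal.mul_rpow_of_nonneg _ _ hq0.le, ← ENNReal.rpow_mul, ← ENNReal.rpow_mul,
            one_div_mul_cancel hq0.ne', ENNReal.rpow_one,
            ENNReal.ofReal_rpow_of_nonneg (by positivity) (by positivity)]
          congr 2
          rw [div_eq_mul_one_div, mul_comm, Real.mul_rpow (by positivity) (by positivity),
            ← Real.rpow_mul ht.le, ← mul_assoc, hbq]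
  set F : ℝ → ℝ≥0∞ := fun s => ENNReal.ofReal (s ^ (q - 1 / 2)) * V s ^ q with hF
  have hFm : Measurable F := by rw [hF]; fun_prop
  set k : ℝ → ℝ≥0∞ := fun t =>
    ENNReal.ofReal ((1 / b) ^ (1 / p * q) * t ^ (-(1 / 2) : ℝ)) with hk
  have hkm : Measurable k := by rw [hk]; fun_prop
  calc ∫⁻ t in Ioi 0, U t ^ q ≤ ∫⁻ t in Ioi 0, k t * ∫⁻ s in Ioi t, F s :=
        setLIntegral_mono' measurableSet_Ioi fun t ht => step t ht
    _ = ∫⁻ t in Ioi (0 : ℝ), ∫⁻ s in Ioi (0 : ℝ), (Ioi t).indicator (fun s => k t * F s) s := by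
        refine setLIntegral_congr_fun measurableSet_Ioi fun t ht => ?_
        rw [setLIntegral_indicator measurableSet_Ioi,
          inter_eq_left.2 (Ioi_subset_Ioi (le_of_lt ht)), lintegral_const_mul _ hFm]
    -- Tonelli on {t < s}; the inner integral of t^{-1/2} over (0, s) then gives 2 s^{1/2}, which
    -- restores s^q.
    _ = ∫⁻ s in Ioi (0 : ℝ), ∫⁻ t in Ioi (0 : ℝ), (Ioi t).indicator (fun s => k t * F s) s := by
        refine lintegral_lintegral_swap (Measurable.aemeasurable ?_)
        have : (Function.uncurry fun t s : ℝ => (Ioi t).indicator (fun s => k t * F s) s) =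
            {z : ℝ × ℝ | z.1 < z.2}.indicator fun z => k z.1 * F z.2 := by
          funext z
          simp [Function.uncurry, indicator]
        rw [this]
        exact Measurable.indicator (by fun_prop) (measurableSet_lt measurable_fst measurable_snd)
    _ = ∫⁻ s in Ioi (0 : ℝ), (∫⁻ t in Ioo 0 s, k t) * F s := by
        refine setLIntegral_congr_fun measurableSet_Ioi fun s hs => ?_
        rw [← lintegral_mul_const _ hkm, ← Ioi_inter_Iio, inter_comm,
          ← setLIntegral_indicator measurableSet_Iio]
        refine lintegral_congr fun t => ?_
        simp [indicator]
    _ = ∫⁻ s in Ioi (0 : ℝ), ENNReal.ofReal ((1 / b) ^ (1 / p * q) * 2) *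
          (ENNReal.ofReal (s ^ q) * V s ^ q) := by
        refine setLIntegral_congr_fun measurableSet_Ioi fun s hs => ?_
        have hs0 : 0 < s := hs
        have h5 : ∫⁻ t in Ioo 0 s, k t =
            ENNReal.ofReal ((1 / b) ^ (1 / p * q)) * ENNReal.ofReal (s ^ (1 / 2 : ℝ) / (1 / 2)) := by
          rw [← lintegral_Ioo_rpow (by norm_num) hs0, ← lintegral_const_mul _ (by fun_prop)]
          refine lintegral_congr fun t => ?_
          rw [hk, ← ENNReal.ofReal_mul (by positivity)]
          norm_num
        rw [h5, hF, ← mul_assoc, ← mul_assoc, ← ENNReal.ofReal_mul (by positivity),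
          ← ENNReal.ofReal_mul (by positivity), ← ENNReal.ofReal_mul (by positivity)]
        congr 2
        rw [show q = 1 / 2 + (q - 1 / 2) by ring, Real.rpow_add hs0]
        ring_nf
    _ = _ := by
        rw [lintegral_const_mul _ (by fun_prop)]
        rfl

/-! ### Pointwise decay of the transformed heat symbol. -/

theorem integrable_heatSymbol {d : ℕ} {a t : ℝ} (ha : 0 < a) (ht : 0 < t)
    {G : EuclideanSpace ℝ (Fin d) → ℂ} (hG : MemLp G 2) : Integrable (heatSymbol a t G) := by
  obtain ⟨C, -, hC⟩ := lintegral_heatSymbol_le ha d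
  refine ⟨aestronglyMeasurable_heatSymbol a t hG.1, (hC G t ht hG.1).trans_lt ?_⟩
  exact ENNReal.mul_lt_top ENNReal.ofReal_lt_top hG.2

theorem memLp_heatSymbol {d : ℕ} {a t : ℝ} (ha : 0 < a) (ht : 0 < t)
    {G : EuclideanSpace ℝ (Fin d) → ℂ} (hG : MemLp G 2) : MemLp (heatSymbol a t G) 2 := by
  obtain ⟨C, -, hC⟩ := lintegral_heatSymbol_sq_le ha
  refine memLp_two_of_lintegral (aestronglyMeasurable_heatSymbol a t hG.1)
    ((hC d G t ht).trans_lt (ENNReal.mul_lt_top ENNReal.ofReal_lt_top ?_))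
  rw [lintegral_enorm_sq_eq_eLpNorm_sq]
  exact ENNReal.pow_lt_top hG.2

theorem enorm_fourier_le_lintegral {V : Type*} [NormedAddCommGroup V] [InnerProductSpace ℝ V]
    [FiniteDimensional ℝ V] [MeasurableSpace V] [BorelSpace V] (h : V → ℂ) (x : V) :
    ‖𝓕 h x‖ₑ ≤ ∫⁻ ξ, ‖h ξ‖ₑ := by
  rw [Real.fourier_eq]
  refine (enorm_integral_le_lintegral_enorm _).trans (le_of_eq ?_)
  refine lintegral_congr fun ξ => ?_
  rw [← ofReal_norm, Circle.norm_smul, ofReal_norm]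

theorem eLpNorm_heatSymbol_le {a : ℝ} (ha : 0 < a) : ∃ C : ℝ, 0 < C ∧
    ∀ (d : ℕ) (G : EuclideanSpace ℝ (Fin d) → ℂ) (t : ℝ), 0 < t →
      eLpNorm (heatSymbol a t G) 2 ≤ ENNReal.ofReal (C * t ^ (-(a / 2))) * eLpNorm G 2 := by
  obtain ⟨C, hC0, hC⟩ := lintegral_heatSymbol_sq_le ha
  refine ⟨C ^ (1 / 2 : ℝ), by positivity, fun d G t ht => ?_⟩
  have h := hC d G t ht
  rw [lintegral_enorm_sq_eq_eLpNorm_sq, lintegral_enorm_sq_eq_eLpNorm_sq] at h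
  rw [← ENNReal.pow_le_pow_left_iff (two_ne_zero), mul_pow]
  convert! h using 2
  rw [← ENNReal.ofReal_pow (by positivity), mul_pow, ← Real.rpow_mul_natCast hC0.le,
    ← Real.rpow_mul_natCast ht.le]
  norm_num

theorem norm_mul_heatSymbol {d : ℕ} {a t : ℝ} (ha : 0 < a)
    (G : EuclideanSpace ℝ (Fin d) → ℂ) (ξ : EuclideanSpace ℝ (Fin d)) :
    2 * Real.pi * ‖ξ‖ * ‖heatSymbol a t G ξ‖ = ‖heatSymbol (a + 1) t G ξ‖ := by
  rw [norm_heatSymbol, norm_heatSymbol, Real.rpow_add_one' (by positivity) (by linarith)]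
  ring

theorem eLpNorm_fourier {d : ℕ} {h : EuclideanSpace ℝ (Fin d) → ℂ}
    (h1 : Integrable h) (h2 : MemLp h 2) : eLpNorm (𝓕 h) 2 = eLpNorm h 2 := by
  have := lintegral_enorm_sq_fourier h1 h2
  rw [lintegral_enorm_sq_eq_eLpNorm_sq, lintegral_enorm_sq_eq_eLpNorm_sq] at this
  exact (ENNReal.pow_right_strictMono two_ne_zero).injective this

theorem norm_le_sum_norm_apply_single {d : ℕ} (L : EuclideanSpace ℝ (Fin d) →L[ℝ] ℂ) :
    ‖L‖ ≤ ∑ j, ‖L (EuclideanSpace.single j 1)‖ := by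
  refine L.opNorm_le_bound (by positivity) fun x => ?_
  have hx : x = ∑ j, x j • EuclideanSpace.single j (1 : ℝ) := by
    have := (EuclideanSpace.basisFun (Fin d) ℝ).sum_repr x
    simpa using this.symm
  calc ‖L x‖ = ‖∑ j, x j • L (EuclideanSpace.single j (1 : ℝ))‖ := by
        conv_lhs => rw [hx]
        simp only [map_sum, map_smul]
    _ ≤ ∑ j, ‖x j‖ * ‖L (EuclideanSpace.single j (1 : ℝ))‖ := by
        refine (norm_sum_le _ _).trans (le_of_eq ?_)
        simp only [norm_smul]
    _ ≤ ∑ j, ‖x‖ * ‖L (EuclideanSpace.single j (1 : ℝ))‖ := by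
        gcongr with j
        exact PiLp.norm_apply_le x j
    _ = _ := by rw [← Finset.mul_sum, mul_comm]

theorem fderiv_fourier_apply {V : Type*} [NormedAddCommGroup V] [InnerProductSpace ℝ V]
    [FiniteDimensional ℝ V] [MeasurableSpace V] [BorelSpace V] {h : V → ℂ}
    (h1 : Integrable h) (h2 : Integrable fun ξ => ‖ξ‖ * ‖h ξ‖) (x e : V) :
    fderiv ℝ (𝓕 h) x e = 𝓕 (fun ξ => -(2 * Real.pi * Complex.I) * inner ℝ ξ e * h ξ) x := by
  have hsm : Integrable (VectorFourier.fourierSMulRight (innerSL ℝ) h) := by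
    refine (h2.const_mul (2 * Real.pi)).mono h1.1.fourierSMulRight
      (Filter.Eventually.of_forall fun ξ => ?_)
    rw [VectorFourier.norm_fourierSMulRight, innerSL_apply_norm, Real.norm_of_nonneg
      (by positivity), mul_assoc]
  rw [Real.fderiv_fourier h1 h2, Real.fourier_continuousLinearMap_apply hsm]
  refine congrArg (fun F : V → ℂ => 𝓕 F x) (funext fun ξ => ?_)
  rw [VectorFourier.fourierSMulRight_apply, innerSL_apply_apply]
  simp [mul_assoc]

theorem contDiff_one_fourier {V : Type*} [NormedAddCommGroup V] [InnerProductSpace ℝ V]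
    [FiniteDimensional ℝ V] [MeasurableSpace V] [BorelSpace V] {h : V → ℂ}
    (h1 : Integrable h) (h2 : Integrable fun ξ => ‖ξ‖ * ‖h ξ‖) : ContDiff ℝ 1 (𝓕 h) := by
  have := Real.contDiff_fourier (f := h) (N := 1) fun n hn => by
    have hn' : n ≤ 1 := by exact_mod_cast hn
    interval_cases n
    · simpa using h1.norm
    · simpa using h2
  exact_mod_cast this

/-- `‖∇𝓕h‖_{L²} ≤ d ‖2π|ξ| h‖_{L²}`. -/
theorem eLpNorm_fderiv_fourier_le {d : ℕ} {h : EuclideanSpace ℝ (Fin d) → ℂ}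
    {k : EuclideanSpace ℝ (Fin d) → ℂ} (h1 : Integrable h) (k1 : Integrable k) (k2 : MemLp k 2)
    (hk : ∀ ξ, 2 * Real.pi * ‖ξ‖ * ‖h ξ‖ ≤ ‖k ξ‖) :
    ContDiff ℝ 1 (𝓕 h) ∧ eLpNorm (fderiv ℝ (𝓕 h)) 2 ≤ d * eLpNorm k 2 := by
  have hp : (1 : ℝ) ≤ 2 * Real.pi := by linarith [Real.pi_gt_three]
  have hint : Integrable fun ξ => ‖ξ‖ * ‖h ξ‖ := by
    refine k1.mono (continuous_norm.aestronglyMeasurable.mul h1.1.norm)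
      (Filter.Eventually.of_forall fun ξ => ?_)
    rw [Real.norm_of_nonneg (by positivity)]
    refine le_trans ?_ (hk ξ)
    have : 0 ≤ ‖ξ‖ * ‖h ξ‖ := by positivity
    nlinarith
  have hcd : ContDiff ℝ 1 (𝓕 h) := contDiff_one_fourier h1 hint
  refine ⟨hcd, ?_⟩
  -- The symbol of the j-th partial derivative. It is dominated by k, and summing over the d
  -- coordinates produces the factor d.
  set m : Fin d → EuclideanSpace ℝ (Fin d) → ℂ := fun j ξ =>
    -(2 * Real.pi * Complex.I) * inner ℝ ξ (EuclideanSpace.single j (1 : ℝ)) * h ξ with hm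
  have hder : ∀ j x, fderiv ℝ (𝓕 h) x (EuclideanSpace.single j 1) = 𝓕 (m j) x := fun j x =>
    fderiv_fourier_apply h1 hint x _
  have hmle : ∀ j ξ, ‖m j ξ‖ ≤ ‖k ξ‖ := fun j ξ => by
    refine (hk ξ).trans' ?_
    have h3 : ‖inner ℝ ξ (EuclideanSpace.single j (1 : ℝ))‖ ≤ ‖ξ‖ := by
      simpa using norm_inner_le_norm (𝕜 := ℝ) ξ (EuclideanSpace.single j (1 : ℝ))
    have h4 : ‖(2 * Real.pi * Complex.I : ℂ)‖ = 2 * Real.pi := by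
      simp [abs_of_pos Real.pi_pos]
    rw [hm, norm_mul, norm_mul, norm_neg, h4, Complex.norm_real]
    gcongr
  have hmm : ∀ j, AEStronglyMeasurable (m j) volume := fun j =>
    AEStronglyMeasurable.mul (Continuous.aestronglyMeasurable (by fun_prop)) h1.1
  have hmi : ∀ j, Integrable (m j) := fun j =>
    k1.mono (hmm j) (Filter.Eventually.of_forall (hmle j))
  have hmL : ∀ j, MemLp (m j) 2 := fun j =>
    k2.mono (hmm j) (Filter.Eventually.of_forall (hmle j))
  have hmeas : ∀ j, AEStronglyMeasurable (fun x => ‖𝓕 (m j) x‖) volume := fun j => by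
    simp_rw [← hder]
    exact (((hcd.continuous_fderiv one_ne_zero).clm_apply
      continuous_const).norm).aestronglyMeasurable
  have h5 : eLpNorm (fderiv ℝ (𝓕 h)) 2 volume ≤
      eLpNorm (∑ j, fun x => ‖𝓕 (m j) x‖) 2 volume := by
    refine eLpNorm_mono_real fun x => ?_
    rw [Finset.sum_apply]
    refine (norm_le_sum_norm_apply_single _).trans (le_of_eq ?_)
    exact Finset.sum_congr rfl fun j _ => by rw [hder j x]
  have h6 : eLpNorm (∑ j, fun x => ‖𝓕 (m j) x‖) 2 volume ≤
      ∑ j, eLpNorm (fun x => ‖𝓕 (m j) x‖) 2 volume :=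
    eLpNorm_sum_le (fun j _ => hmeas j) one_le_two
  have h7 : ∀ j, eLpNorm (fun x => ‖𝓕 (m j) x‖) 2 volume ≤ eLpNorm k 2 volume := fun j => by
    rw [eLpNorm_norm (𝓕 (m j)), eLpNorm_fourier (hmi j) (hmL j)]
    exact eLpNorm_mono (hmle j)
  refine h5.trans (h6.trans ((Finset.sum_le_sum fun j _ => h7 j).trans (le_of_eq ?_)))
  rw [Finset.sum_const, Finset.card_univ, Fintype.card_fin, nsmul_eq_mul]

/-- Decay of `𝓕(ρ^a e^{-tρ²} G)` away from the origin, in the radial case. -/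
theorem enorm_fourier_heatSymbol_le_of_radial {d : ℕ} (hd : 1 ≤ d) {a : ℝ} (ha : 0 < a) :
    ∃ C : ℝ, 0 < C ∧ ∀ (G : EuclideanSpace ℝ (Fin d) → ℂ) (t : ℝ), 0 < t → MemLp G 2 →
      IsRadialFun (𝓕 (heatSymbol a t G)) → ∀ x, 1 / 2 ≤ ‖x‖ →
      ‖𝓕 (heatSymbol a t G) x‖ₑ ≤ ENNReal.ofReal (C * t ^ (-(a / 2) - 1 / 4)) * eLpNorm G 2 := by
  obtain ⟨C₀, hC₀, h₀⟩ := radial_sobolev hd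
  obtain ⟨C₁, hC₁, h₁⟩ := eLpNorm_heatSymbol_le ha
  obtain ⟨C₂, hC₂, h₂⟩ := eLpNorm_heatSymbol_le (a := a + 1) (by linarith)
  have hd0 : (0 : ℝ) < d := by exact_mod_cast hd
  refine ⟨((C₀ : ℝ) * (C₁ * (d * C₂))) ^ (1 / 2 : ℝ), by positivity, fun G t ht hG hr x hx => ?_⟩
  have hi := integrable_heatSymbol ha ht hG
  obtain ⟨hcd, hle⟩ := eLpNorm_fderiv_fourier_le hi
    (integrable_heatSymbol (a := a + 1) (by linarith) ht hG)
    (memLp_heatSymbol (a := a + 1) (by linarith) ht hG)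
    (fun ξ => (norm_mul_heatSymbol ha G ξ).le)
  have hz : Filter.Tendsto (𝓕 (heatSymbol a t G)) (Filter.cocompact _) (nhds 0) :=
    tendsto_integral_exp_inner_smul_cocompact _
  have h := h₀ _ hcd hr hz x hx
  rw [eLpNorm_fourier hi (memLp_heatSymbol ha ht hG)] at h
  -- The function contributes t^{-a/2} and its gradient, having one more power of ρ, t^{-(a+1)/2};
  -- the geometric mean of the two is t^{-a/2-1/4}.
  have h' : ‖𝓕 (heatSymbol a t G) x‖ₑ ^ 2 ≤
      ENNReal.ofReal ((C₀ : ℝ) * (C₁ * t ^ (-(a / 2)) * (d * (C₂ * t ^ (-((a + 1) / 2)))))) *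
        eLpNorm G 2 ^ 2 := by
    calc _ ≤ (C₀ : ℝ≥0∞) * ((ENNReal.ofReal (C₁ * t ^ (-(a / 2))) * eLpNorm G 2) *
          (d * (ENNReal.ofReal (C₂ * t ^ (-((a + 1) / 2))) * eLpNorm G 2))) := by
          refine h.trans ?_
          gcongr
          · exact h₁ d G t ht
          · exact hle.trans (by gcongr; exact h₂ d G t ht)
      _ = _ := by
          rw [ENNReal.ofReal_mul (p := (C₀ : ℝ)) (by positivity),
            ENNReal.ofReal_mul (p := C₁ * t ^ (-(a / 2))) (by positivity),
            ENNReal.ofReal_mul (p := (d : ℝ)) (by positivity), ENNReal.ofReal_coe_nnreal,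
            ENNReal.ofReal_natCast]
          ring
  rw [← ENNReal.pow_le_pow_left_iff (two_ne_zero), mul_pow]
  refine h'.trans (le_of_eq ?_)
  congr 1
  rw [← ENNReal.ofReal_pow (by positivity), mul_pow, ← Real.rpow_mul_natCast (by positivity),
    ← Real.rpow_mul_natCast ht.le]
  congr 1
  rw [show (-(a / 2) - 1 / 4) * ((2 : ℕ) : ℝ) = -(a / 2) + -((a + 1) / 2) by push_cast; ring,
    Real.rpow_add ht]
  norm_num
  ring

theorem enorm_fourier_heatSymbol_le {d : ℕ} {a : ℝ} (ha : 0 < a) :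
    ∃ C : ℝ, 0 < C ∧ ∀ (G : EuclideanSpace ℝ (Fin d) → ℂ) (t : ℝ), 0 < t → MemLp G 2 → ∀ x,
      ‖𝓕 (heatSymbol a t G) x‖ₑ ≤
        ENNReal.ofReal (C * t ^ (-(a / 2) - (d : ℝ) / 4)) * eLpNorm G 2 := by
  obtain ⟨C, hC, h⟩ := lintegral_heatSymbol_le ha d
  exact ⟨C, hC, fun G t ht hG x => (enorm_fourier_le_lintegral _ x).trans (h G t ht hG.1)⟩

/-- The exponent κ/2 lies between 1/4 and d/4, so the radial bound is the stronger one for t ≤ 1 and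
the general bound for t ≥ 1. -/
theorem enorm_fourier_heatSymbol_le_interpolated {d : ℕ} (hd : 1 ≤ d) {a κ : ℝ} (ha : 0 < a)
    (hκ1 : 1 / 2 ≤ κ) (hκ2 : κ ≤ (d : ℝ) / 2) :
    ∃ C : ℝ, 0 < C ∧ ∀ (G : EuclideanSpace ℝ (Fin d) → ℂ) (t : ℝ), 0 < t → MemLp G 2 →
      IsRadialFun (𝓕 (heatSymbol a t G)) → ∀ x, 1 / 2 ≤ ‖x‖ →
      ‖𝓕 (heatSymbol a t G) x‖ₑ ≤ ENNReal.ofReal (C * t ^ (-(a / 2) - κ / 2)) * eLpNorm G 2 := by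
  obtain ⟨C₁, hC₁, h₁⟩ := enorm_fourier_heatSymbol_le_of_radial hd ha
  obtain ⟨C₂, hC₂, h₂⟩ := enorm_fourier_heatSymbol_le (d := d) ha
  refine ⟨max C₁ C₂, by positivity, fun G t ht hG hr x hx => ?_⟩
  rcases le_total t 1 with h1 | h1
  · refine (h₁ G t ht hG hr x hx).trans ?_
    gcongr ENNReal.ofReal (?_ * ?_) * _
    · exact le_max_left _ _
    · exact Real.rpow_le_rpow_of_exponent_ge ht h1 (by linarith)
  · refine (h₂ G t ht hG x).trans ?_
    gcongr ENNReal.ofReal (?_ * ?_) * _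
    · exact le_max_right _ _
    · exact Real.rpow_le_rpow_of_exponent_le h1 (by linarith)

/-! ### Evolution in time. -/

theorem ae_norm_pos {d : ℕ} (hd : 1 ≤ d) : ∀ᵐ ξ : EuclideanSpace ℝ (Fin d), 0 < ‖ξ‖ := by
  have : Nonempty (Fin d) := ⟨⟨0, hd⟩⟩
  filter_upwards [compl_mem_ae_iff.2
    (measure_singleton (μ := volume) (0 : EuclideanSpace ℝ (Fin d)))] with ξ hξ
  exact norm_pos_iff.2 hξ

theorem continuous_fourier_phase {X V : Type*} [TopologicalSpace X] [NormedAddCommGroup V]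
    [InnerProductSpace ℝ V] {f g : X → V} (hf : Continuous f) (hg : Continuous g) :
    Continuous fun p => Complex.exp ((-2 * Real.pi * inner ℝ (f p) (g p) : ℝ) * Complex.I) := by
  fun_prop

theorem measurable_fourier_heatSymbol {d : ℕ} (a : ℝ) {G : EuclideanSpace ℝ (Fin d) → ℂ}
    (hG : StronglyMeasurable G) : StronglyMeasurable
      fun z : ℝ × EuclideanSpace ℝ (Fin d) => 𝓕 (heatSymbol a z.1 G) z.2 := by
  simp_rw [Real.fourier_eq']
  refine StronglyMeasurable.integral_prod_right'
    (f := fun p : (ℝ × EuclideanSpace ℝ (Fin d)) × EuclideanSpace ℝ (Fin d) =>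
      Complex.exp ((-2 * Real.pi * inner ℝ p.2 p.1.2 : ℝ) * Complex.I) •
        heatSymbol a p.1.1 G p.2) ?_
  refine StronglyMeasurable.smul (continuous_fourier_phase continuous_snd
    (continuous_snd.comp continuous_fst)).stronglyMeasurable ?_
  refine StronglyMeasurable.mul (Measurable.stronglyMeasurable (by fun_prop))
    (hG.comp_measurable measurable_snd)

theorem norm_heatSymbol_anti {d : ℕ} (a : ℝ) {s t : ℝ} (hst : s ≤ t)
    (G : EuclideanSpace ℝ (Fin d) → ℂ) (ξ : EuclideanSpace ℝ (Fin d)) :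
    ‖heatSymbol a t G ξ‖ ≤ ‖heatSymbol a s G ξ‖ := by
  rw [norm_heatSymbol, norm_heatSymbol]
  gcongr

theorem hasDerivAt_heatSymbol {d : ℕ} {a : ℝ} (ha : a + 2 ≠ 0)
    (G : EuclideanSpace ℝ (Fin d) → ℂ) (ξ : EuclideanSpace ℝ (Fin d)) (t : ℝ) :
    HasDerivAt (fun t => heatSymbol a t G ξ) (-heatSymbol (a + 2) t G ξ) t := by
  set r := 2 * Real.pi * ‖ξ‖ with hr
  have h1 : HasDerivAt (fun t : ℝ => r ^ a * Real.exp (-(t * r ^ 2)))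
      (-(r ^ (a + 2) * Real.exp (-(t * r ^ 2)))) t := by
    have h2 : HasDerivAt (fun t : ℝ => -(t * r ^ 2)) (-(1 * r ^ 2)) t :=
      ((hasDerivAt_id t).mul_const _).neg
    convert! (h2.exp.const_mul (r ^ a)) using 1
    -- At ξ = 0 the identity r^{a+2} = r^a r² needs a + 2 ≠ 0, since 0^0 = 1.
    rw [Real.rpow_add' (by positivity) ha, Real.rpow_two]
    ring
  have h3 := h1.ofReal_comp.mul_const (G ξ)
  convert! h3 using 1
  simp only [heatSymbol, ← hr]
  push_cast
  ring

/-- The heat equation for `𝓕(ρ^a e^{-tρ²} G)`. -/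
theorem hasDerivAt_fourier_heatSymbol {d : ℕ} {a : ℝ} (ha : 0 < a + 2)
    {G : EuclideanSpace ℝ (Fin d) → ℂ} (hG : MemLp G 2)
    (hint : ∀ t, 0 < t → Integrable (heatSymbol a t G)) (x : EuclideanSpace ℝ (Fin d))
    {t : ℝ} (ht : 0 < t) :
    HasDerivAt (fun t => 𝓕 (heatSymbol a t G) x) (-𝓕 (heatSymbol (a + 2) t G) x) t := by
  have hnorm : ∀ (c : ℝ) (z : ℂ), ‖Complex.exp ((c : ℂ) * Complex.I) • z‖ = ‖z‖ := fun c z => by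
    rw [norm_smul, Complex.norm_exp_ofReal_mul_I, one_mul]
  have hm : ∀ (b s : ℝ), AEStronglyMeasurable (fun ξ : EuclideanSpace ℝ (Fin d) =>
      Complex.exp ((-2 * Real.pi * inner ℝ ξ x : ℝ) * Complex.I) • heatSymbol b s G ξ) :=
    fun b s => AEStronglyMeasurable.smul (continuous_fourier_phase continuous_id continuous_const).aestronglyMeasurable
      (aestronglyMeasurable_heatSymbol b s hG.1)
  have hneg : -𝓕 (heatSymbol (a + 2) t G) x = ∫ ξ,
      Complex.exp ((-2 * Real.pi * inner ℝ ξ x : ℝ) * Complex.I) •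
        (-heatSymbol (a + 2) t G ξ) := by
    rw [Real.fourier_eq', ← integral_neg]
    simp only [smul_neg]
  rw [hneg]
  simp_rw [Real.fourier_eq']
  -- On (t/2, ∞) the derivative is dominated by its value at t/2, because the symbol decreases in
  -- time.
  refine (hasDerivAt_integral_of_dominated_loc_of_deriv_le
    (F := fun s ξ => Complex.exp ((-2 * Real.pi * inner ℝ ξ x : ℝ) * Complex.I) •
      heatSymbol a s G ξ)
    (F' := fun s ξ => Complex.exp ((-2 * Real.pi * inner ℝ ξ x : ℝ) * Complex.I) •
      (-heatSymbol (a + 2) s G ξ))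
    (bound := fun ξ => ‖heatSymbol (a + 2) (t / 2) G ξ‖)
    (Ioi_mem_nhds (half_lt_self ht)) (Filter.Eventually.of_forall fun s => hm a s) ?_ ?_ ?_ ?_
    ?_).2
  · exact (hint t ht).mono (hm a t) (Filter.Eventually.of_forall fun ξ => (hnorm _ _).le)
  · simp only [smul_neg]
    exact (hm (a + 2) t).neg
  · refine Filter.Eventually.of_forall fun ξ s hs => ?_
    rw [hnorm, norm_neg]
    exact norm_heatSymbol_anti _ (le_of_lt hs) G ξ
  · exact (integrable_heatSymbol ha (half_pos ht) hG).norm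
  · exact Filter.Eventually.of_forall fun ξ s _ =>
      (hasDerivAt_heatSymbol ha.ne' G ξ s).fun_const_smul _

/-- Dominated convergence with the symbol at time 1 as majorant. The Gaussian factor tends to 0 only
for ξ ≠ 0, which is almost everywhere as d ≥ 1. -/
theorem tendsto_fourier_heatSymbol_atTop {d : ℕ} (hd : 1 ≤ d) {a : ℝ}
    {G : EuclideanSpace ℝ (Fin d) → ℂ} (hG : AEStronglyMeasurable G)
    (hint : Integrable (heatSymbol a 1 G)) (x : EuclideanSpace ℝ (Fin d)) :
    Filter.Tendsto (fun t => 𝓕 (heatSymbol a t G) x) Filter.atTop (nhds 0) := by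
  have hnorm : ∀ (c : ℝ) (z : ℂ), ‖Complex.exp ((c : ℂ) * Complex.I) • z‖ = ‖z‖ := fun c z => by
    rw [norm_smul, Complex.norm_exp_ofReal_mul_I, one_mul]
  simp_rw [Real.fourier_eq']
  rw [← integral_zero (EuclideanSpace ℝ (Fin d)) ℂ]
  refine tendsto_integral_filter_of_dominated_convergence (fun ξ => ‖heatSymbol a 1 G ξ‖)
    (Filter.Eventually.of_forall fun s =>
      AEStronglyMeasurable.smul (continuous_fourier_phase continuous_id continuous_const).aestronglyMeasurable
        (aestronglyMeasurable_heatSymbol a s hG)) ?_ hint.norm ?_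
  · filter_upwards [Filter.eventually_ge_atTop 1] with t ht
    refine Filter.Eventually.of_forall fun ξ => ?_
    rw [hnorm]
    exact norm_heatSymbol_anti _ ht G ξ
  · filter_upwards [ae_norm_pos hd] with ξ hξ
    rw [tendsto_zero_iff_norm_tendsto_zero]
    simp_rw [hnorm, norm_heatSymbol]
    have hr : 0 < (2 * Real.pi * ‖ξ‖) ^ 2 := by positivity
    have h1 : Filter.Tendsto (fun t : ℝ => Real.exp (-(t * (2 * Real.pi * ‖ξ‖) ^ 2)))
        Filter.atTop (nhds 0) :=
      Real.tendsto_exp_neg_atTop_nhds_zero.comp (Filter.tendsto_id.atTop_mul_const hr)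
    simpa using (h1.const_mul ((2 * Real.pi * ‖ξ‖) ^ a)).mul_const ‖G ξ‖

/-- A time derivative raises the power of ρ by 2. This reduces the possibly negative power -δ to the
positive power 2 - δ, for which the decay bounds are available. -/
theorem enorm_fourier_heatSymbol_le_lintegral_Ioi {d : ℕ} (hd : 1 ≤ d) {a : ℝ} (ha : 0 < a + 2)
    {G : EuclideanSpace ℝ (Fin d) → ℂ} (hG : MemLp G 2) (hGm : StronglyMeasurable G)
    (hint : ∀ t, 0 < t → Integrable (heatSymbol a t G)) (x : EuclideanSpace ℝ (Fin d))
    {t : ℝ} (ht : 0 < t) :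
    ‖𝓕 (heatSymbol a t G) x‖ₑ ≤ ∫⁻ s in Ioi t, ‖𝓕 (heatSymbol (a + 2) s G) x‖ₑ := by
  have h := enorm_le_lintegral_Ioi_of_hasDerivAt (r := t)
    (fun s hs => hasDerivAt_fourier_heatSymbol ha hG hint x (ht.trans_le hs)) ?_
    (tendsto_fourier_heatSymbol_atTop hd hG.1 (hint 1 one_pos) x)
  · simpa only [enorm_neg] using h
  · exact ((measurable_fourier_heatSymbol (a + 2) hGm).comp_measurable
      measurable_prodMk_right).neg.aestronglyMeasurable

/-- The heat equation transfers radiality: the functions of t at x and at Ax agree for t > 0, so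
their derivatives agree. -/
theorem isRadialFun_fourier_heatSymbol_add_two {d : ℕ} {a : ℝ} (ha : 0 < a + 2)
    {G : EuclideanSpace ℝ (Fin d) → ℂ} (hG : MemLp G 2)
    (hint : ∀ t, 0 < t → Integrable (heatSymbol a t G))
    (hrad : ∀ t, 0 < t → IsRadialFun (𝓕 (heatSymbol a t G))) {t : ℝ} (ht : 0 < t) :
    IsRadialFun (𝓕 (heatSymbol (a + 2) t G)) := fun A x => by
  have h1 := hasDerivAt_fourier_heatSymbol ha hG hint (A x) ht
  have h2 := hasDerivAt_fourier_heatSymbol ha hG hint x ht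
  have h3 : (fun t => 𝓕 (heatSymbol a t G) (A x)) =ᶠ[nhds t]
      fun t => 𝓕 (heatSymbol a t G) x := by
    filter_upwards [Ioi_mem_nhds ht] with s hs
    exact hrad s hs A x
  exact neg_injective (h1.unique (h2.congr_of_eventuallyEq h3))

/-! ### The estimate away from the origin. -/

/-- `∫_0^∞ t^{b-1} |ρ^b e^{-tρ²} G|² dt ≲ |G|²`. -/
theorem lintegral_Ioi_heatSymbol_sq {d : ℕ} (hd : 1 ≤ d) {b : ℝ} (hb : 0 < b)
    (G : EuclideanSpace ℝ (Fin d) → ℂ) :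
    ∀ᵐ ξ, ∫⁻ t in Ioi (0 : ℝ), ENNReal.ofReal (t ^ (b - 1)) * ‖heatSymbol b t G ξ‖ₑ ^ 2 =
      ENNReal.ofReal ((1 / 2) ^ b * Real.Gamma b) * ‖G ξ‖ₑ ^ 2 := by
  filter_upwards [ae_norm_pos hd] with ξ hξ
  set r := 2 * Real.pi * ‖ξ‖ with hr
  have hr0 : 0 < r := by positivity
  have h1 : ∀ t ∈ Ioi (0 : ℝ), ENNReal.ofReal (t ^ (b - 1)) * ‖heatSymbol b t G ξ‖ₑ ^ 2 =
      ENNReal.ofReal (r ^ (2 * b)) * ‖G ξ‖ₑ ^ 2 *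
        ENNReal.ofReal (t ^ (b - 1) * Real.exp (-(2 * r ^ 2 * t))) := fun t ht => by
    have ht0 : 0 < t := ht
    rw [enorm_heatSymbol, ← hr, mul_pow, ← ENNReal.ofReal_pow (by positivity), mul_pow,
      ← Real.rpow_mul_natCast hr0.le, ← Real.exp_nat_mul,
      ENNReal.ofReal_mul (p := r ^ (b * (2 : ℕ))) (by positivity),
      ENNReal.ofReal_mul (p := t ^ (b - 1)) (by positivity),
      show b * ((2 : ℕ) : ℝ) = 2 * b by push_cast; ring,
      show ((2 : ℕ) : ℝ) * -(t * r ^ 2) = -(2 * r ^ 2 * t) by push_cast; ring]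
    ring
  -- The Gamma integral equals Γ(b) (2r²)^{-b}, whose power of r cancels the factor r^{2b} of the
  -- squared symbol.
  have h2 := Real.integral_rpow_mul_exp_neg_mul_Ioi hb (r := 2 * r ^ 2) (by positivity)
  have h3 : IntegrableOn (fun t : ℝ => t ^ (b - 1) * Real.exp (-(2 * r ^ 2 * t))) (Ioi 0) :=
    .of_integral_ne_zero (by
      rw [h2]
      have := Real.Gamma_pos_of_pos hb
      positivity)
  rw [setLIntegral_congr_fun measurableSet_Ioi h1, lintegral_const_mul' _ _ (by finiteness),
    ← ofReal_integral_eq_lintegral_ofReal h3, h2, mul_right_comm,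
    ← ENNReal.ofReal_mul (by positivity)]
  · congr 2
    have h4 : (1 / (2 * r ^ 2)) ^ b = (1 / 2) ^ b * r ^ (-(2 * b)) := by
      rw [show 1 / (2 * r ^ 2) = (1 / 2) * (r ^ (2 : ℝ))⁻¹ by rw [Real.rpow_two]; field_simp,
        Real.mul_rpow (by norm_num) (by positivity), ← Real.rpow_neg hr0.le,
        ← Real.rpow_mul hr0.le]
      congr 2; ring
    rw [h4, Real.rpow_neg hr0.le]
    have : r ^ (2 * b) ≠ 0 := by positivity
    field_simp
  · filter_upwards [ae_restrict_mem measurableSet_Ioi] with t ht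
    have ht0 : 0 < t := ht
    positivity

theorem lintegral_Ioi_enorm_fourier_heatSymbol_rpow_le {d : ℕ} (hd : 1 ≤ d) {q a : ℝ} (hq : 1 < q)
    (ha : 0 < a + 2) : ∃ C : ℝ≥0, ∀ G : EuclideanSpace ℝ (Fin d) → ℂ, MemLp G 2 →
      StronglyMeasurable G → (∀ t, 0 < t → Integrable (heatSymbol a t G)) → ∀ x,
      ∫⁻ t in Ioi 0, ‖𝓕 (heatSymbol a t G) x‖ₑ ^ q ≤
        C * ∫⁻ t in Ioi 0, ENNReal.ofReal (t ^ q) * ‖𝓕 (heatSymbol (a + 2) t G) x‖ₑ ^ q := by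
  obtain ⟨C, h⟩ := hardy_inequality hq
  refine ⟨C, fun G hG hGm hint x => ?_⟩
  have hm : Measurable fun t => ‖𝓕 (heatSymbol (a + 2) t G) x‖ₑ :=
    ((measurable_fourier_heatSymbol (a + 2) hGm).comp_measurable
      measurable_prodMk_right).enorm
  exact h _ _ hm fun t ht =>
    enorm_fourier_heatSymbol_le_lintegral_Ioi hd ha hG hGm hint x ht

/-- The space-time estimate away from the origin, in the radial case. -/
theorem exterior_estimate {d : ℕ} (hd : 1 ≤ d) {q δ κ : ℝ} (hq : 2 < q) (hδ : δ < 2)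
    (hκ1 : 1 / 2 ≤ κ) (hκ2 : κ ≤ (d : ℝ) / 2) (hκ : δ * q + 2 = κ * (q - 2)) :
    ∃ C : ℝ≥0, ∀ G : EuclideanSpace ℝ (Fin d) → ℂ, MemLp G 2 → StronglyMeasurable G →
      (∀ t, 0 < t → Integrable (heatSymbol (-δ) t G)) →
      (∀ t, 0 < t → IsRadialFun (𝓕 (heatSymbol (-δ) t G))) →
      ∫⁻ x in {x : EuclideanSpace ℝ (Fin d) | 1 / 2 ≤ ‖x‖}, ∫⁻ t in Ioi 0, ‖𝓕 (heatSymbol (-δ) t G) x‖ₑ ^ q ≤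
        C * eLpNorm G 2 ^ q := by
  have ha0 : 0 < -δ + 2 := by linarith
  obtain ⟨C₁, h₁⟩ := lintegral_Ioi_enorm_fourier_heatSymbol_rpow_le hd (q := q) (by linarith) ha0
  set a := -δ + 2 with ha
  obtain ⟨C₂, hC₂, h₂⟩ := enorm_fourier_heatSymbol_le_interpolated hd ha0 hκ1 hκ2
  refine ⟨C₁ * (C₂ ^ (q - 2) * ((1 / 2) ^ a * Real.Gamma a)).toNNReal, fun G hG hGm hint hrad => ?_⟩
  set N := eLpNorm G 2 volume with hN
  have hNt : N ≠ ∞ := hG.2.ne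
  set v : ℝ → EuclideanSpace ℝ (Fin d) → ℂ := fun t x => 𝓕 (heatSymbol a t G) x with hv
  have hvm : Measurable fun z : ℝ × EuclideanSpace ℝ (Fin d) => ‖v z.1 z.2‖ₑ :=
    (measurable_fourier_heatSymbol a hGm).measurable.enorm
  have hE : MeasurableSet {x : EuclideanSpace ℝ (Fin d) | 1 / 2 ≤ ‖x‖} :=
    measurableSet_le measurable_const measurable_norm
  -- Of the q factors of |v|, q - 2 are bounded pointwise and two are kept for Plancherel.
  -- Restricting to the exterior matters only for the pointwise bound.
  have hpt : ∀ t ∈ Ioi (0 : ℝ),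
      ∫⁻ x in {x : EuclideanSpace ℝ (Fin d) | 1 / 2 ≤ ‖x‖}, ENNReal.ofReal (t ^ q) * ‖v t x‖ₑ ^ q ≤
      ENNReal.ofReal (C₂ ^ (q - 2)) * N ^ (q - 2) *
        ∫⁻ ξ, ENNReal.ofReal (t ^ (a - 1)) * ‖heatSymbol a t G ξ‖ₑ ^ 2 := fun t ht => by
    have ht0 : 0 < t := ht
    have hr := isRadialFun_fourier_heatSymbol_add_two ha0 hG hint hrad ht0
    have h3 : ∀ x ∈ {x : EuclideanSpace ℝ (Fin d) | 1 / 2 ≤ ‖x‖},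
        ENNReal.ofReal (t ^ q) * ‖v t x‖ₑ ^ q ≤
        ENNReal.ofReal (C₂ ^ (q - 2)) * N ^ (q - 2) *
          (ENNReal.ofReal (t ^ (a - 1)) * ‖v t x‖ₑ ^ 2) := fun x hx => by
      have h4 := h₂ G t ht0 hG hr x hx
      have h5 : ‖v t x‖ₑ ^ q = ‖v t x‖ₑ ^ (q - 2) * ‖v t x‖ₑ ^ 2 := by
        rw [← ENNReal.rpow_two, ← ENNReal.rpow_add_of_nonneg _ _ (by linarith) (by norm_num)]
        congr 1; ring
      have h6 : ‖v t x‖ₑ ^ (q - 2) ≤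
          ENNReal.ofReal (C₂ ^ (q - 2) * t ^ (a - 1 - q)) * N ^ (q - 2) := by
        calc ‖v t x‖ₑ ^ (q - 2)
            ≤ (ENNReal.ofReal (C₂ * t ^ (-(a / 2) - κ / 2)) * N) ^ (q - 2) :=
              ENNReal.rpow_le_rpow h4 (by linarith)
          _ = _ := by
            rw [ENNReal.mul_rpow_of_nonneg _ _ (by linarith),
              ENNReal.ofReal_rpow_of_nonneg (by positivity) (by linarith),
              Real.mul_rpow hC₂.le (by positivity), ← Real.rpow_mul ht0.le]
            congr 4
            -- The relation `hκ` is exactly (q - 2)(-a/2 - κ/2) = a - 1 - q.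
            rw [ha]; linarith
      rw [h5]
      calc _ ≤ ENNReal.ofReal (t ^ q) * ((ENNReal.ofReal (C₂ ^ (q - 2) * t ^ (a - 1 - q)) *
            N ^ (q - 2)) * ‖v t x‖ₑ ^ 2) := by gcongr
        _ = _ := by
          have : ENNReal.ofReal (t ^ (a - 1)) =
              ENNReal.ofReal (t ^ q) * ENNReal.ofReal (t ^ (a - 1 - q)) := by
            rw [← ENNReal.ofReal_mul (by positivity), ← Real.rpow_add ht0]
            congr 2; ring
          rw [this, ENNReal.ofReal_mul (by positivity)]
          ring
    have h7 : ∫⁻ x, ‖v t x‖ₑ ^ 2 = ∫⁻ ξ, ‖heatSymbol a t G ξ‖ₑ ^ 2 :=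
      lintegral_enorm_sq_fourier (integrable_heatSymbol ha0 ht0 hG) (memLp_heatSymbol ha0 ht0 hG)
    calc _ ≤ ∫⁻ x in {x : EuclideanSpace ℝ (Fin d) | 1 / 2 ≤ ‖x‖},
          ENNReal.ofReal (C₂ ^ (q - 2)) * N ^ (q - 2) *
          (ENNReal.ofReal (t ^ (a - 1)) * ‖v t x‖ₑ ^ 2) := setLIntegral_mono' hE h3
      _ ≤ ∫⁻ x, ENNReal.ofReal (C₂ ^ (q - 2)) * N ^ (q - 2) *
          (ENNReal.ofReal (t ^ (a - 1)) * ‖v t x‖ₑ ^ 2) := setLIntegral_le_lintegral _ _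
      _ = _ := by
        have hNq : N ^ (q - 2) ≠ ∞ := ENNReal.rpow_ne_top_of_nonneg (by linarith) hNt
        rw [lintegral_const_mul' _ _ (ENNReal.mul_ne_top ENNReal.ofReal_ne_top hNq),
          lintegral_const_mul' _ _ ENNReal.ofReal_ne_top,
          lintegral_const_mul' _ _ ENNReal.ofReal_ne_top, h7]
  have hsm : StronglyMeasurable fun z : ℝ × EuclideanSpace ℝ (Fin d) => heatSymbol a z.1 G z.2 :=
    StronglyMeasurable.mul (Measurable.stronglyMeasurable (by fun_prop))
      (hGm.comp_measurable measurable_snd)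
  have hNq : N ^ (q - 2) ≠ ∞ := ENNReal.rpow_ne_top_of_nonneg (by linarith) hNt
  have e1 : ∫⁻ x in {x : EuclideanSpace ℝ (Fin d) | 1 / 2 ≤ ‖x‖}, ∫⁻ t in Ioi 0, ‖𝓕 (heatSymbol (-δ) t G) x‖ₑ ^ q ≤
      ∫⁻ x in {x : EuclideanSpace ℝ (Fin d) | 1 / 2 ≤ ‖x‖},
        C₁ * ∫⁻ t in Ioi 0, ENNReal.ofReal (t ^ q) * ‖v t x‖ₑ ^ q :=
    lintegral_mono fun x => h₁ G hG hGm hint x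
  have e2 : ∫⁻ x in {x : EuclideanSpace ℝ (Fin d) | 1 / 2 ≤ ‖x‖},
        C₁ * ∫⁻ t in Ioi 0, ENNReal.ofReal (t ^ q) * ‖v t x‖ₑ ^ q =
      C₁ * ∫⁻ t in Ioi (0 : ℝ), ∫⁻ x in {x : EuclideanSpace ℝ (Fin d) | 1 / 2 ≤ ‖x‖},
        ENNReal.ofReal (t ^ q) * ‖v t x‖ₑ ^ q := by
    rw [lintegral_const_mul' _ _ ENNReal.coe_ne_top, lintegral_lintegral_swap]
    refine Measurable.aemeasurable ?_
    exact Measurable.mul (by fun_prop) ((hvm.comp measurable_swap).pow_const q)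
  have e3 : ∫⁻ t in Ioi (0 : ℝ), ∫⁻ x in {x : EuclideanSpace ℝ (Fin d) | 1 / 2 ≤ ‖x‖},
        ENNReal.ofReal (t ^ q) * ‖v t x‖ₑ ^ q ≤
      ∫⁻ t in Ioi (0 : ℝ), ENNReal.ofReal (C₂ ^ (q - 2)) * N ^ (q - 2) *
        ∫⁻ ξ, ENNReal.ofReal (t ^ (a - 1)) * ‖heatSymbol a t G ξ‖ₑ ^ 2 :=
    setLIntegral_mono' measurableSet_Ioi hpt
  -- Integrating in t first, at fixed frequency, turns the weighted square function into ‖G‖₂²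
  -- without loss.
  have e4 : ∫⁻ t in Ioi (0 : ℝ), ENNReal.ofReal (C₂ ^ (q - 2)) * N ^ (q - 2) *
        ∫⁻ ξ, ENNReal.ofReal (t ^ (a - 1)) * ‖heatSymbol a t G ξ‖ₑ ^ 2 =
      ENNReal.ofReal (C₂ ^ (q - 2)) * N ^ (q - 2) *
        ∫⁻ ξ, ∫⁻ t in Ioi (0 : ℝ), ENNReal.ofReal (t ^ (a - 1)) * ‖heatSymbol a t G ξ‖ₑ ^ 2 := by
    rw [lintegral_const_mul' _ _ (ENNReal.mul_ne_top ENNReal.ofReal_ne_top hNq),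
      lintegral_lintegral_swap]
    refine Measurable.aemeasurable ?_
    exact Measurable.mul (by fun_prop) (hsm.measurable.enorm.pow_const 2)
  have e5 : ∫⁻ ξ, ∫⁻ t in Ioi (0 : ℝ), ENNReal.ofReal (t ^ (a - 1)) *
      ‖heatSymbol a t G ξ‖ₑ ^ 2 = ENNReal.ofReal ((1 / 2) ^ a * Real.Gamma a) * N ^ 2 := by
    rw [lintegral_congr_ae (lintegral_Ioi_heatSymbol_sq hd ha0 G),
      lintegral_const_mul' _ _ ENNReal.ofReal_ne_top, lintegral_enorm_sq_eq_eLpNorm_sq]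
  have h8 : N ^ q = N ^ (q - 2) * N ^ 2 := by
    rw [← ENNReal.rpow_two, ← ENNReal.rpow_add_of_nonneg _ _ (by linarith) (by norm_num)]
    congr 1; ring
  have h9 : (((C₂ ^ (q - 2) * ((1 / 2) ^ a * Real.Gamma a)).toNNReal : ℝ≥0) : ℝ≥0∞) =
      ENNReal.ofReal (C₂ ^ (q - 2)) * ENNReal.ofReal ((1 / 2) ^ a * Real.Gamma a) :=
    ENNReal.ofReal_mul (Real.rpow_nonneg hC₂.le _)
  rw [e4, e5] at e3
  refine e1.trans (e2.le.trans ((mul_le_mul_right e3 _).trans (le_of_eq ?_)))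
  rw [h8, ENNReal.coe_mul, h9]
  ring

/-! ### Tempered distributions: support, radiality and the Fourier formula for the flow. -/

open scoped Manifold ContDiff in
/-- A tempered distribution vanishes on compactly supported test functions whose support does not
meet the support of the distribution. -/
theorem eq_zero_of_tsupport_subset_compl_dsupport {V : Type*} [NormedAddCommGroup V]
    [InnerProductSpace ℝ V] [FiniteDimensional ℝ V] (f : 𝓢'(V, ℂ)) (φ : 𝓢(V, ℂ))
    (hc : HasCompactSupport φ) (hφ : tsupport φ ⊆ (Distribution.dsupport f)ᶜ) : f φ = 0 := by
  have h1 : ∀ x : tsupport φ, ∃ s : Set V, Distribution.IsVanishingOn f s ∧ IsOpen s ∧ (x : V) ∈ s :=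
    fun x => (Distribution.notMem_dsupport_iff (x : V)).1 (hφ x.2)
  choose s hs hso hxs using h1
  obtain ⟨T, hT⟩ := hc.isCompact.elim_finite_subcover s hso
    fun x hx => mem_iUnion.2 ⟨⟨x, hx⟩, hxs ⟨x, hx⟩⟩
  -- The support of φ is compact, so finitely many vanishing sets cover it. A subordinate partition
  -- of unity writes φ as a finite sum of test functions, each killed by f.
  obtain ⟨p, hp⟩ := SmoothPartitionOfUnity.exists_isSubordinate (ι := T) 𝓘(ℝ, V)
    (isClosed_tsupport φ) (fun i => s i) (fun i => hso i) (by
      intro x hx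
      obtain ⟨i, hi, hxi⟩ := mem_iUnion₂.1 (hT hx)
      exact mem_iUnion.2 ⟨⟨i, hi⟩, hxi⟩)
  have hsm : ∀ i, ContDiff ℝ ∞ fun x => (p i x : ℂ) * φ x := fun i =>
    (Complex.ofRealCLM.contDiff.comp (p i).contMDiff.contDiff).mul (φ.smooth ⊤)
  have hcs : ∀ i, HasCompactSupport fun x => (p i x : ℂ) * φ x := fun i => hc.mul_left
  have hsum : φ = ∑ i, (hcs i).toSchwartzMap (hsm i) := by
    ext x
    rw [sum_apply]
    simp only [HasCompactSupport.toSchwartzMap_toFun]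
    by_cases hx : x ∈ tsupport φ
    · have h2 := p.sum_eq_one hx
      rw [finsum_eq_sum_of_fintype] at h2
      rw [← Finset.sum_mul]
      have h3 : ∑ i, ((p i x : ℝ) : ℂ) = 1 := by rw [← Complex.ofReal_sum, h2, Complex.ofReal_one]
      rw [h3, one_mul]
    · simp [image_eq_zero_of_notMem_tsupport hx]
  rw [hsum, map_sum]
  refine Finset.sum_eq_zero fun i _ => hs i _ ?_
  refine subset_trans ?_ (hp i)
  refine closure_mono fun x hx => ?_
  simp only [Function.mem_support, HasCompactSupport.toSchwartzMap_toFun] at hx ⊢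
  intro h0
  simp [h0] at hx

theorem HasFourierFunction.apply_eq {d : ℕ} {f : 𝓢'(EuclideanSpace ℝ (Fin d), ℂ)}
    {g : EuclideanSpace ℝ (Fin d) → ℂ} (hg : HasFourierFunction f g)
    (φ : 𝓢(EuclideanSpace ℝ (Fin d), ℂ)) : f φ = ∫ ξ, 𝓕⁻ φ ξ * g ξ := by
  rw [← (hg (𝓕⁻ φ)).2, TemperedDistribution.fourier_apply, FourierTransform.fourier_fourierInv_eq]

/-- The inverse Fourier transform of the translated heat kernel. -/
theorem fourierInv_heatKernel_translate {d : ℕ} {t : ℝ} (ht : 0 < t)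
    (x ξ : EuclideanSpace ℝ (Fin d)) :
    𝓕⁻ ((heatKernel t).compSubConstCLM ℂ x) ξ =
      Complex.exp ((2 * Real.pi * inner ℝ ξ x : ℝ) * Complex.I) *
        (Real.exp (-(t * (2 * Real.pi * ‖ξ‖) ^ 2)) : ℂ) := by
  set b : ℝ := 4 * Real.pi ^ 2 * t with hb
  have hb0 : 0 < b := by positivity
  set Φ : EuclideanSpace ℝ (Fin d) → ℂ := fun v =>
    Complex.exp (-(b : ℂ) * ‖v‖ ^ 2 + 2 * Real.pi * Complex.I * inner ℝ x v) with hΦ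
  -- The translated kernel is recognised as the Fourier transform of the modulated Gaussian Φ;
  -- Fourier inversion then gives the claim.
  have h1 : (((heatKernel t).compSubConstCLM ℂ x : 𝓢(EuclideanSpace ℝ (Fin d), ℂ)) :
      EuclideanSpace ℝ (Fin d) → ℂ) = 𝓕 Φ := by
    funext w
    rw [hΦ, fourier_gaussian_innerProductSpace' (by simpa using hb0) x w,
      SchwartzMap.compSubConstCLM_apply, heatKernel_apply ht, heatKernelFun, norm_sub_rev w x,
      finrank_euclideanSpace_fin]
    push_cast
    congr 1
    · rw [Complex.ofReal_cpow (by positivity)]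
      have : (Real.pi : ℂ) / b = ((4 * Real.pi * t)⁻¹ : ℝ) := by
        rw [hb]; push_cast
        have : (Real.pi : ℂ) ≠ 0 := by exact_mod_cast Real.pi_ne_zero
        have : (t : ℂ) ≠ 0 := by exact_mod_cast ht.ne'
        field_simp
      rw [this, ← Complex.ofReal_natCast, show ((d : ℝ) : ℂ) / 2 = ((d / 2 : ℝ) : ℂ) by push_cast; rfl,
        ← Complex.ofReal_cpow (by positivity), ← Complex.ofReal_cpow (by positivity),
        Real.inv_rpow (by positivity), ← Real.rpow_neg (by positivity), neg_div]
    · congr 1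
      rw [hb]; push_cast
      have : (Real.pi : ℂ) ≠ 0 := by exact_mod_cast Real.pi_ne_zero
      have : (t : ℂ) ≠ 0 := by exact_mod_cast ht.ne'
      field_simp
  have hΦc : Continuous Φ := by rw [hΦ]; fun_prop
  have hΦi : Integrable Φ :=
    GaussianFourier.integrable_cexp_neg_mul_sq_norm_add (by simpa using hb0) _ x
  have h2 : 𝓕⁻ (𝓕 Φ) = Φ := hΦc.fourierInv_fourier_eq hΦi (by
    rw [← h1]; exact SchwartzMap.integrable _)
  rw [SchwartzMap.fourierInv_coe, h1, h2, Complex.ofReal_exp, ← Complex.exp_add]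
  refine congrArg Complex.exp ?_
  rw [hb, real_inner_comm]
  push_cast
  ring

theorem IsRadialDistribution.heatFlow_apply_linearIsometryEquiv {d : ℕ}
    {f : 𝓢'(EuclideanSpace ℝ (Fin d), ℂ)} (hf : IsRadialDistribution f) {t : ℝ} (ht : 0 < t)
    (A : EuclideanSpace ℝ (Fin d) ≃ₗᵢ[ℝ] EuclideanSpace ℝ (Fin d))
    (x : EuclideanSpace ℝ (Fin d)) : heatFlow f t (A x) = heatFlow f t x := by
  rw [heatFlow, heatFlow, ← hf A.symm ((heatKernel t).compSubConstCLM ℂ x)]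
  congr 1
  ext y
  simp only [SchwartzMap.compCLMOfContinuousLinearEquiv_apply, Function.comp_apply,
    SchwartzMap.compSubConstCLM_apply, heatKernel_apply ht, heatKernelFun]
  have : ‖y - A x‖ = ‖A.symm.toContinuousLinearEquiv y - x‖ := by
    change _ = ‖A.symm y - x‖
    rw [← A.norm_map (A.symm y - x), map_sub, A.apply_symm_apply]
  rw [this]

/-- The representation of the heat flow through the function `G = (2π|ξ|)^δ f̂`. -/
theorem heatFlow_eq_fourierInv_heatSymbol {d : ℕ} (hd : 1 ≤ d)
    {f : 𝓢'(EuclideanSpace ℝ (Fin d), ℂ)} {g G : EuclideanSpace ℝ (Fin d) → ℂ} {δ : ℝ}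
    (hg : HasFourierFunction f g)
    (hG : G =ᵐ[volume] fun ξ => (((2 * Real.pi * ‖ξ‖) ^ δ : ℝ) : ℂ) * g ξ) {t : ℝ} (ht : 0 < t) :
    Integrable (heatSymbol (-δ) t G) ∧
      ∀ x, heatFlow f t x = 𝓕⁻ (heatSymbol (-δ) t G) x := by
  have hae : ∀ᵐ ξ : EuclideanSpace ℝ (Fin d), heatSymbol (-δ) t G ξ =
      (Real.exp (-(t * (2 * Real.pi * ‖ξ‖) ^ 2)) : ℂ) * g ξ := by
    filter_upwards [hG, ae_norm_pos hd] with ξ h1 h2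
    have h3 : (2 * Real.pi * ‖ξ‖) ^ (-δ) * (2 * Real.pi * ‖ξ‖) ^ δ = 1 := by
      rw [← Real.rpow_add (by positivity)]; simp
    have h4 : (((2 * Real.pi * ‖ξ‖) ^ (-δ) : ℝ) : ℂ) * (((2 * Real.pi * ‖ξ‖) ^ δ : ℝ) : ℂ) = 1 := by
      rw [← Complex.ofReal_mul, h3, Complex.ofReal_one]
    rw [heatSymbol, h1, Complex.ofReal_mul]
    linear_combination (Real.exp (-(t * (2 * Real.pi * ‖ξ‖) ^ 2)) : ℂ) * g ξ * h4
  refine ⟨?_, fun x => ?_⟩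
  · have h := (hg (𝓕⁻ ((heatKernel t).compSubConstCLM ℂ 0))).1
    simp_rw [fourierInv_heatKernel_translate ht] at h
    refine h.congr ?_
    filter_upwards [hae] with ξ h1
    rw [h1]
    simp
  · rw [heatFlow, hg.apply_eq, Real.fourierInv_eq']
    refine integral_congr_ae ?_
    filter_upwards [hae] with ξ h1
    rw [h1, fourierInv_heatKernel_translate ht, smul_eq_mul, mul_assoc]

/-- The map x ↦ -x is a linear isometry, so the flow is even and 𝓕⁻ may be replaced by 𝓕. -/
theorem IsRadialDistribution.heatFlow_eq_fourier_heatSymbol {d : ℕ} (hd : 1 ≤ d)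
    {f : 𝓢'(EuclideanSpace ℝ (Fin d), ℂ)} (hf : IsRadialDistribution f)
    {g G : EuclideanSpace ℝ (Fin d) → ℂ} {δ : ℝ} (hg : HasFourierFunction f g)
    (hG : G =ᵐ[volume] fun ξ => (((2 * Real.pi * ‖ξ‖) ^ δ : ℝ) : ℂ) * g ξ) {t : ℝ} (ht : 0 < t)
    (x : EuclideanSpace ℝ (Fin d)) : heatFlow f t x = 𝓕 (heatSymbol (-δ) t G) x := by
  rw [← hf.heatFlow_apply_linearIsometryEquiv ht (LinearIsometryEquiv.neg ℝ) x,
    (heatFlow_eq_fourierInv_heatSymbol hd hg hG ht).2, Real.fourierInv_eq_fourier_neg]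
  simp

/-! ### Small times near the origin: duality with a smooth test function. -/

/-- For d ≥ 2 and y < 1 the radial density y^{d-1} is at most y, and y^{1-2δ} is integrable at 0
since δ < 1. This handles the low frequencies. -/
theorem lintegral_ball_norm_rpow_lt_top {d : ℕ} (hd : 2 ≤ d) {δ : ℝ} (hδ : δ < 1) :
    ∫⁻ ξ : EuclideanSpace ℝ (Fin d),
      (Iio (1 : ℝ)).indicator (fun y => ENNReal.ofReal (y ^ (-(2 * δ)))) ‖ξ‖ < ∞ := by
  have : Nonempty (Fin d) := ⟨⟨0, by omega⟩⟩
  have hm : Measurable ((Iio (1 : ℝ)).indicator fun y : ℝ => ENNReal.ofReal (y ^ (-(2 * δ)))) :=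
    Measurable.indicator (by fun_prop) measurableSet_Iio
  rw [lintegral_fun_norm_addHaar volume hm]
  refine ENNReal.mul_lt_top (measure_lt_top _ _) ?_
  have h1 := lintegral_Ioo_rpow (b := 2 - 2 * δ) (by linarith) one_pos
  calc _ ≤ ∫⁻ y in Ioi (0 : ℝ),
        (Iio (1 : ℝ)).indicator (fun y => ENNReal.ofReal (y ^ (2 - 2 * δ - 1))) y := by
        refine setLIntegral_mono' measurableSet_Ioi fun y hy => ?_
        have hy0 : 0 < y := hy
        by_cases h : y < 1
        · rw [indicator_of_mem (mem_Iio.2 h), indicator_of_mem (mem_Iio.2 h),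
            ← ENNReal.ofReal_mul (by positivity)]
          refine ENNReal.ofReal_le_ofReal ?_
          rw [finrank_euclideanSpace_fin, show 2 - 2 * δ - 1 = 1 + -(2 * δ) by ring,
            Real.rpow_add hy0, Real.rpow_one]
          gcongr
          exact pow_le_of_le_one hy0.le h.le (by omega)
        · simp [h]
    _ = ∫⁻ y in Ioo (0 : ℝ) 1, ENNReal.ofReal (y ^ (2 - 2 * δ - 1)) := by
        rw [setLIntegral_indicator measurableSet_Iio, inter_comm, Ioi_inter_Iio]
    _ < ∞ := by rw [h1]; exact ENNReal.ofReal_lt_top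

/-- For δ ≤ 0 the power -2δ lies in [0, 2], so the first two terms suffice. For δ ≥ 0 the weight is
at most 1 when r ≥ 1 and is singular only near 0. The three terms will be paired with ‖φ‖₂², ‖∇φ‖₂²
and ‖φ‖₁². -/
theorem rpow_neg_two_mul_le {δ r : ℝ} (h1 : -1 ≤ δ) (hr : 0 < r) :
    ENNReal.ofReal ((2 * Real.pi * r) ^ (-(2 * δ))) ≤
      1 + ENNReal.ofReal ((2 * Real.pi * r) ^ 2) +
        (Iio (1 : ℝ)).indicator (fun y => ENNReal.ofReal (y ^ (-(2 * max δ 0)))) r := by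
  have hp : (1 : ℝ) ≤ 2 * Real.pi := by linarith [Real.pi_gt_three]
  rcases le_total δ 0 with hδ | hδ
  · refine le_add_right ?_
    rw [← ENNReal.ofReal_one, ← ENNReal.ofReal_add zero_le_one (by positivity)]
    refine ENNReal.ofReal_le_ofReal ?_
    rcases le_total (2 * Real.pi * r) 1 with h | h
    · have := Real.rpow_le_one (by positivity) h (z := -(2 * δ)) (by linarith)
      nlinarith [sq_nonneg (2 * Real.pi * r)]
    · have := Real.rpow_le_rpow_of_exponent_le h (show -(2 * δ) ≤ 2 by linarith)
      rw [Real.rpow_two] at this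
      linarith
  · rw [max_eq_left hδ]
    by_cases h : r < 1
    · rw [indicator_of_mem (mem_Iio.2 h)]
      refine le_add_left (ENNReal.ofReal_le_ofReal ?_)
      refine Real.rpow_le_rpow_of_nonpos hr ?_ (by linarith)
      nlinarith
    · refine le_add_right (le_add_right ?_)
      rw [← ENNReal.ofReal_one]
      refine ENNReal.ofReal_le_ofReal ?_
      push Not at h
      exact Real.rpow_le_one_of_one_le_of_nonpos (by nlinarith) (by linarith)

/-- `∫ |2πξ|² |φ̂|² = ∑ⱼ ∫ |∂ⱼφ|²`. -/
theorem lintegral_sq_mul_fourier_sq {d : ℕ} (φ : 𝓢(EuclideanSpace ℝ (Fin d), ℂ)) :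
    ∫⁻ ξ, ENNReal.ofReal ((2 * Real.pi * ‖ξ‖) ^ 2) * ‖𝓕 φ ξ‖ₑ ^ 2 =
      ∑ j : Fin d, ∫⁻ y, ‖(∂_{EuclideanSpace.single j (1 : ℝ)} φ : 𝓢(EuclideanSpace ℝ (Fin d), ℂ)) y‖ₑ ^ 2 := by
  have h1 : ∀ j : Fin d, ∫⁻ y, ‖(∂_{EuclideanSpace.single j (1 : ℝ)} φ : 𝓢(EuclideanSpace ℝ (Fin d), ℂ)) y‖ₑ ^ 2 =
      ∫⁻ ξ, ‖𝓕 (∂_{EuclideanSpace.single j (1 : ℝ)} φ : 𝓢(EuclideanSpace ℝ (Fin d), ℂ)) ξ‖ₑ ^ 2 := fun j =>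
    (lintegral_enorm_sq_fourier (SchwartzMap.integrable _)
      ((∂_{EuclideanSpace.single j (1 : ℝ)} φ : 𝓢(EuclideanSpace ℝ (Fin d), ℂ)).memLp 2)).symm
  simp_rw [h1]
  rw [← lintegral_finsetSum' _ fun j _ => by
    exact ((SchwartzMap.continuous _).enorm.measurable.pow_const 2).aemeasurable]
  refine lintegral_congr fun ξ => ?_
  have h2 : ∀ j : Fin d, ‖𝓕 (∂_{EuclideanSpace.single j (1 : ℝ)} φ : 𝓢(EuclideanSpace ℝ (Fin d), ℂ)) ξ‖ₑ ^ 2 =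
      ENNReal.ofReal ((2 * Real.pi * ‖ξ j‖) ^ 2) * ‖𝓕 φ ξ‖ₑ ^ 2 := fun j => by
    rw [SchwartzMap.fourier_lineDerivOp_eq]
    have hg : (fun y : EuclideanSpace ℝ (Fin d) =>
        inner ℝ y (EuclideanSpace.single j (1 : ℝ))).HasTemperateGrowth := by fun_prop
    rw [smul_apply, SchwartzMap.smulLeftCLM_apply_apply hg, ← ofReal_norm,
      ← ofReal_norm, ← ENNReal.ofReal_pow (by positivity), ← ENNReal.ofReal_pow (by positivity),
      ← ENNReal.ofReal_mul (by positivity)]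
    congr 1
    rw [norm_smul, norm_smul, EuclideanSpace.inner_single_right]
    simp [abs_of_pos Real.pi_pos]
    ring
  simp_rw [h2]
  rw [← Finset.sum_mul, ← ENNReal.ofReal_sum_of_nonneg fun j _ => by positivity]
  congr 2
  simp_rw [mul_pow]
  rw [← Finset.mul_sum, EuclideanSpace.norm_sq_eq]

/-- A weighted bound for the Fourier transform of a Schwartz function which is dominated, together
with its first derivatives, by a translated Gaussian. -/
theorem lintegral_rpow_mul_fourier_sq_le {d : ℕ} (hd : 2 ≤ d) {δ : ℝ} (h1 : -1 ≤ δ) (h2 : δ < 1) :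
    ∃ C : ℝ≥0, ∀ (φ : 𝓢(EuclideanSpace ℝ (Fin d), ℂ)) (B : ℝ) (x : EuclideanSpace ℝ (Fin d)),
      0 ≤ B → (∀ y, ‖φ y‖ ≤ B * Real.exp (-(1 / 8) * ‖y - x‖ ^ 2)) →
      (∀ (j : Fin d) y, ‖(∂_{EuclideanSpace.single j (1 : ℝ)} φ : 𝓢(EuclideanSpace ℝ (Fin d), ℂ)) y‖ ≤
        B * Real.exp (-(1 / 8) * ‖y - x‖ ^ 2)) →
      ∫⁻ ξ, ENNReal.ofReal ((2 * Real.pi * ‖ξ‖) ^ (-(2 * δ))) * ‖𝓕 φ ξ‖ₑ ^ 2 ≤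
        C * ENNReal.ofReal B ^ 2 := by
  set w : EuclideanSpace ℝ (Fin d) → ℝ≥0∞ := fun z =>
    ENNReal.ofReal (Real.exp (-(1 / 8) * ‖z‖ ^ 2)) with hw
  have hwm : Measurable w := by rw [hw]; fun_prop
  have hwfin : ∀ c : ℝ, 0 < c → ∫⁻ z : EuclideanSpace ℝ (Fin d),
      ENNReal.ofReal (Real.exp (-c * ‖z‖ ^ 2)) < ∞ := fun c hc => by
    obtain ⟨C, -, hC⟩ := lintegral_exp_neg_mul_norm_sq d
    have := hC (c / (2 * Real.pi) ^ 2) (by positivity)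
    have e : ∀ z : EuclideanSpace ℝ (Fin d), -(c / (2 * Real.pi) ^ 2 * (2 * Real.pi * ‖z‖) ^ 2) =
        -c * ‖z‖ ^ 2 := fun z => by
      have := Real.pi_ne_zero
      field_simp
    simp_rw [e] at this
    rw [this]; exact ENNReal.ofReal_lt_top
  have hW1 : ∫⁻ z, w z < ∞ := hwfin _ (by norm_num)
  have hW2 : ∫⁻ z, w z ^ 2 < ∞ := by
    have e : ∀ z, w z ^ 2 = ENNReal.ofReal (Real.exp (-(1 / 4) * ‖z‖ ^ 2)) := fun z => by
      rw [hw, ← ENNReal.ofReal_pow (by positivity), ← Real.exp_nat_mul]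
      congr 2; push_cast; ring
    simp_rw [e]
    exact hwfin _ (by norm_num)
  have hS := lintegral_ball_norm_rpow_lt_top hd (δ := max δ 0) (max_lt h2 one_pos)
  set S := ∫⁻ ξ : EuclideanSpace ℝ (Fin d),
    (Iio (1 : ℝ)).indicator (fun y => ENNReal.ofReal (y ^ (-(2 * max δ 0)))) ‖ξ‖ with hSdef
  have hfin : (∫⁻ z, w z ^ 2) + d * (∫⁻ z, w z ^ 2) + S * (∫⁻ z, w z) ^ 2 ≠ ∞ :=
    ENNReal.add_ne_top.2 ⟨ENNReal.add_ne_top.2 ⟨hW2.ne, ENNReal.mul_ne_top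
      (ENNReal.natCast_ne_top d) hW2.ne⟩, ENNReal.mul_ne_top hS.ne (ENNReal.pow_ne_top hW1.ne)⟩
  refine ⟨((∫⁻ z, w z ^ 2) + d * (∫⁻ z, w z ^ 2) + S * (∫⁻ z, w z) ^ 2).toNNReal,
    fun φ B x hB hφ hdφ => ?_⟩
  rw [ENNReal.coe_toNNReal hfin]
  have hle : ∀ ψ : EuclideanSpace ℝ (Fin d) → ℂ,
      (∀ y, ‖ψ y‖ ≤ B * Real.exp (-(1 / 8) * ‖y - x‖ ^ 2)) →
      ∀ y, ‖ψ y‖ₑ ≤ ENNReal.ofReal B * w (y - x) := fun ψ h y => by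
    rw [hw, ← ENNReal.ofReal_mul hB, ← ofReal_norm]
    exact ENNReal.ofReal_le_ofReal (h y)
  have hsq : ∀ ψ : EuclideanSpace ℝ (Fin d) → ℂ,
      (∀ y, ‖ψ y‖ ≤ B * Real.exp (-(1 / 8) * ‖y - x‖ ^ 2)) →
      ∫⁻ y, ‖ψ y‖ₑ ^ 2 ≤ ENNReal.ofReal B ^ 2 * ∫⁻ z, w z ^ 2 := fun ψ h => by
    rw [← lintegral_sub_right_eq_self (fun z => w z ^ 2) x,
      ← lintegral_const_mul' _ _ (ENNReal.pow_ne_top ENNReal.ofReal_ne_top)]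
    refine lintegral_mono fun y => ?_
    rw [← mul_pow]
    exact pow_le_pow_left₀ zero_le (hle ψ h y) 2
  have hone : ∫⁻ y, ‖φ y‖ₑ ≤ ENNReal.ofReal B * ∫⁻ z, w z := by
    rw [← lintegral_sub_right_eq_self w x, ← lintegral_const_mul' _ _ ENNReal.ofReal_ne_top]
    exact lintegral_mono (hle φ hφ)
  have h1t : ∫⁻ y, ‖φ y‖ₑ ≠ ∞ :=
    (hone.trans_lt (ENNReal.mul_lt_top ENNReal.ofReal_lt_top hW1)).ne
  have hFm : AEMeasurable (fun ξ => ‖𝓕 φ ξ‖ₑ ^ 2) volume :=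
    ((SchwartzMap.continuous _).enorm.measurable.pow_const 2).aemeasurable
  -- In the low-frequency term |φ̂| is replaced by its bound ‖φ‖₁, leaving an integrable weight;
  -- Plancherel treats the other two terms.
  have e1 : ∫⁻ ξ, ENNReal.ofReal ((2 * Real.pi * ‖ξ‖) ^ (-(2 * δ))) * ‖𝓕 φ ξ‖ₑ ^ 2 ≤
      ∫⁻ ξ, (‖𝓕 φ ξ‖ₑ ^ 2 + ENNReal.ofReal ((2 * Real.pi * ‖ξ‖) ^ 2) * ‖𝓕 φ ξ‖ₑ ^ 2 +
        (Iio (1 : ℝ)).indicator (fun y => ENNReal.ofReal (y ^ (-(2 * max δ 0)))) ‖ξ‖ *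
          (∫⁻ y, ‖φ y‖ₑ) ^ 2) := by
    refine lintegral_mono_ae ?_
    filter_upwards [ae_norm_pos (d := d) (by omega)] with ξ hξ
    have h3 : ‖𝓕 φ ξ‖ₑ ≤ ∫⁻ y, ‖φ y‖ₑ := enorm_fourier_le_lintegral φ ξ
    calc _ ≤ (1 + ENNReal.ofReal ((2 * Real.pi * ‖ξ‖) ^ 2) +
          (Iio (1 : ℝ)).indicator (fun y => ENNReal.ofReal (y ^ (-(2 * max δ 0)))) ‖ξ‖) *
          ‖𝓕 φ ξ‖ₑ ^ 2 := by
          gcongr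
          exact rpow_neg_two_mul_le h1 hξ
      _ ≤ _ := by
          rw [add_mul, add_mul, one_mul]
          gcongr
  have e2 : ∫⁻ ξ, ‖𝓕 φ ξ‖ₑ ^ 2 = ∫⁻ y, ‖φ y‖ₑ ^ 2 :=
    lintegral_enorm_sq_fourier φ.integrable (φ.memLp 2)
  have e3 : ∑ j : Fin d, ∫⁻ y, ‖(∂_{EuclideanSpace.single j (1 : ℝ)} φ : 𝓢(EuclideanSpace ℝ (Fin d), ℂ)) y‖ₑ ^ 2 ≤
      d * (ENNReal.ofReal B ^ 2 * ∫⁻ z, w z ^ 2) := by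
    refine (Finset.sum_le_sum fun j _ => hsq _ (hdφ j)).trans (le_of_eq ?_)
    rw [Finset.sum_const, Finset.card_univ, Fintype.card_fin, nsmul_eq_mul]
  refine e1.trans ?_
  rw [lintegral_add_left' (by fun_prop), lintegral_add_left' hFm,
    lintegral_sq_mul_fourier_sq, e2, lintegral_mul_const' _ _ (ENNReal.pow_ne_top h1t)]
  calc _ ≤ ENNReal.ofReal B ^ 2 * (∫⁻ z, w z ^ 2) +
        d * (ENNReal.ofReal B ^ 2 * ∫⁻ z, w z ^ 2) + S * (ENNReal.ofReal B * ∫⁻ z, w z) ^ 2 := by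
        gcongr
        exact hsq φ hφ
    _ = _ := by ring

/-- Bounds for the heat kernel and its gradient away from the origin, uniform for small times. -/
theorem heatKernelFun_le_gaussian {d : ℕ} (hd : 1 ≤ d) : ∃ B : ℝ, 0 ≤ B ∧ ∀ t : ℝ, 0 < t → t ≤ 1 →
    ∀ z : EuclideanSpace ℝ (Fin d), 1 / 4 ≤ ‖z‖ →
      heatKernelFun t z ≤ B * Real.exp (-(1 / 8) * ‖z‖ ^ 2) ∧
      heatKernelFun t z * (‖z‖ / (2 * t)) ≤ B * Real.exp (-(1 / 8) * ‖z‖ ^ 2) := by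
  have hd0 : (0 : ℝ) < d / 2 := by
    have : (0 : ℝ) < d := by exact_mod_cast hd
    positivity
  set m : ℝ := d / 2 with hm
  have hB1 : 0 ≤ (128 : ℝ) ^ m * m ^ m := by positivity
  have hB2 : 0 ≤ (128 : ℝ) ^ m * (16 * (m + 1) ^ (m + 1)) := by positivity
  refine ⟨128 ^ m * m ^ m + 128 ^ m * (16 * (m + 1) ^ (m + 1)), by positivity,
    fun t ht ht1 z hz => ?_⟩
  set r := ‖z‖ with hr
  have hr0 : 0 < r := by linarith
  -- The exponential splits as e^{-r²/(4t)} = e^{-s} e^{-s}. One factor absorbs all negative powers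
  -- of t, as 1/t ≤ 128 s for r ≥ 1/4; the other is at most e^{-r²/8}, as t ≤ 1.
  set s := r ^ 2 / (8 * t) with hs
  have hs0 : 0 < s := by positivity
  have hr2 : 1 / 16 ≤ r ^ 2 := by nlinarith
  have h1 : t⁻¹ ≤ 128 * s := by
    have : 128 * s = 16 * r ^ 2 * t⁻¹ := by rw [hs]; field_simp; ring
    rw [this]
    have : 0 < t⁻¹ := by positivity
    nlinarith
  have h2 : (4 * Real.pi * t) ^ (-(d : ℝ) / 2) ≤ 128 ^ m * s ^ m := by
    rw [← Real.mul_rpow (by norm_num) hs0.le, show -(d : ℝ) / 2 = -m by rw [hm]; ring,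
      Real.rpow_neg (by positivity), ← Real.inv_rpow (by positivity)]
    refine Real.rpow_le_rpow (by positivity) (le_trans ?_ h1) hd0.le
    refine inv_anti₀ ht ?_
    have : 1 ≤ 4 * Real.pi := by linarith [Real.pi_gt_three]
    nlinarith
  have h3 : Real.exp (-(1 / (4 * t)) * r ^ 2) ≤ Real.exp (-s) * Real.exp (-(1 / 8) * r ^ 2) := by
    rw [← Real.exp_add]
    refine Real.exp_le_exp.2 ?_
    have h4 : -(1 / (4 * t)) * r ^ 2 = -s + -s := by rw [hs]; field_simp; ring
    have h5 : (1 / 8) * r ^ 2 ≤ s := by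
      rw [hs, le_div_iff₀ (by positivity)]
      nlinarith [sq_nonneg r]
    linarith
  have h6 := rpow_mul_exp_neg_le hd0 hs0.le
  have h7 := rpow_mul_exp_neg_le (b := m + 1) (by linarith) hs0.le
  rw [Real.rpow_add_one hs0.ne'] at h7
  have h8 : r / (2 * t) ≤ 16 * s := by
    have : 16 * s = 4 * r ^ 2 / (2 * t) := by rw [hs]; field_simp; ring
    rw [this]
    gcongr
    nlinarith
  have h9 : heatKernelFun t z ≤
      128 ^ m * (s ^ m * Real.exp (-s)) * Real.exp (-(1 / 8) * r ^ 2) := by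
    calc heatKernelFun t z ≤ 128 ^ m * s ^ m * (Real.exp (-s) * Real.exp (-(1 / 8) * r ^ 2)) := by
          rw [heatKernelFun]; gcongr
      _ = _ := by ring
  constructor
  · refine h9.trans ?_
    gcongr
    calc 128 ^ m * (s ^ m * Real.exp (-s)) ≤ 128 ^ m * m ^ m := by gcongr
      _ ≤ _ := by linarith
  · calc heatKernelFun t z * (r / (2 * t))
        ≤ 128 ^ m * (s ^ m * Real.exp (-s)) * Real.exp (-(1 / 8) * r ^ 2) * (16 * s) := by gcongr
      _ = 128 ^ m * (16 * (s ^ m * s * Real.exp (-s))) * Real.exp (-(1 / 8) * r ^ 2) := by ring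
      _ ≤ _ := by
        gcongr
        calc 128 ^ m * (16 * (s ^ m * s * Real.exp (-s)))
            ≤ 128 ^ m * (16 * (m + 1) ^ (m + 1)) := by gcongr
          _ ≤ _ := by linarith

theorem exists_hasFDerivAt_heatKernelFun {d : ℕ} {t : ℝ} (ht : 0 < t)
    (z : EuclideanSpace ℝ (Fin d)) : ∃ L : EuclideanSpace ℝ (Fin d) →L[ℝ] ℝ,
      HasFDerivAt (heatKernelFun t) L z ∧ ‖L‖ ≤ heatKernelFun t z * (‖z‖ / (2 * t)) := by
  have h1 : HasFDerivAt (fun x : EuclideanSpace ℝ (Fin d) => ‖x‖ ^ 2) (2 • innerSL ℝ z) z :=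
    (hasStrictFDerivAt_norm_sq z).hasFDerivAt
  have h2 := ((h1.const_mul (-(1 / (4 * t)))).exp).const_mul ((4 * Real.pi * t) ^ (-(d : ℝ) / 2))
  refine ⟨_, h2, ?_⟩
  have hk : 0 ≤ (4 * Real.pi * t) ^ (-(d : ℝ) / 2) := by positivity
  rw [norm_smul, norm_smul, norm_smul, Real.norm_of_nonneg hk, Real.norm_of_nonneg
    (Real.exp_pos _).le, Real.norm_eq_abs, abs_neg, abs_of_pos (by positivity : 0 < 1 / (4 * t)),
    heatKernelFun]
  have h3 : ‖(2 : ℕ) • innerSL ℝ z‖ ≤ 2 * ‖z‖ := by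
    refine (norm_nsmul_le).trans ?_
    rw [innerSL_apply_norm]
    simp
  have h4 : 1 / (4 * t) * ‖(2 : ℕ) • innerSL ℝ z‖ ≤ ‖z‖ / (2 * t) := by
    calc 1 / (4 * t) * ‖(2 : ℕ) • innerSL ℝ z‖ ≤ 1 / (4 * t) * (2 * ‖z‖) :=
          mul_le_mul_of_nonneg_left h3 (by positivity)
      _ = _ := by field_simp; ring
  exact (mul_le_mul_of_nonneg_left (mul_le_mul_of_nonneg_left h4 (Real.exp_pos _).le) hk).trans_eq
    (mul_assoc _ _ _).symm

/-- For `|x| ≤ 1/2` and `t ≤ 1` the heat flow of a distribution supported in `|y| ≥ 1` is the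
pairing with a test function that is uniformly dominated, together with its first derivatives, by a
translated Gaussian. -/
theorem exists_testFunction_heatFlow {d : ℕ} (hd : 1 ≤ d) : ∃ B : ℝ, 0 ≤ B ∧
    ∀ f : 𝓢'(EuclideanSpace ℝ (Fin d), ℂ), Distribution.dsupport f ⊆ {x | 1 ≤ ‖x‖} →
    ∀ t : ℝ, 0 < t → t ≤ 1 → ∀ x : EuclideanSpace ℝ (Fin d), ‖x‖ ≤ 1 / 2 →
      ∃ φ : 𝓢(EuclideanSpace ℝ (Fin d), ℂ), heatFlow f t x = f φ ∧
        (∀ y, ‖φ y‖ ≤ B * Real.exp (-(1 / 8) * ‖y - x‖ ^ 2)) ∧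
        (∀ (j : Fin d) y,
          ‖(∂_{EuclideanSpace.single j (1 : ℝ)} φ : 𝓢(EuclideanSpace ℝ (Fin d), ℂ)) y‖ ≤
            B * Real.exp (-(1 / 8) * ‖y - x‖ ^ 2)) := by
  obtain ⟨B, hB0, hB⟩ := heatKernelFun_le_gaussian hd
  -- The cutoff equals 1 for |y| ≤ 3/4 and is supported in |y| ≤ 7/8, off the support of f; hence f
  -- does not see χK. On the rest |y| ≥ 3/4, so |y - x| ≥ 1/4 and the kernel is harmless.
  let χ : ContDiffBump (0 : EuclideanSpace ℝ (Fin d)) := ⟨3 / 4, 7 / 8, by norm_num, by norm_num⟩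
  have hχd : ContDiff ℝ ((⊤ : ℕ∞) : WithTop ℕ∞) χ := χ.contDiff
  obtain ⟨M, hM⟩ : ∃ M : ℝ, ∀ y, ‖fderiv ℝ χ y‖ ≤ M :=
    (χ.hasCompactSupport.fderiv ℝ).exists_bound_of_continuous
      (hχd.continuous_fderiv (by simp))
  have hM0 : 0 ≤ M := (norm_nonneg _).trans (hM 0)
  refine ⟨(1 + M) * B, by positivity, fun f hf t ht ht1 x hx => ?_⟩
  set K : 𝓢(EuclideanSpace ℝ (Fin d), ℂ) := (heatKernel t).compSubConstCLM ℂ x with hK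
  have hKy : ∀ y, K y = (heatKernelFun t (y - x) : ℂ) := fun y => by
    rw [hK, SchwartzMap.compSubConstCLM_apply, heatKernel_apply ht]
  have hk0 : ∀ z : EuclideanSpace ℝ (Fin d), 0 ≤ heatKernelFun t z := fun z => by
    rw [heatKernelFun]; positivity
  have hχc : HasCompactSupport fun y => (χ y : ℂ) :=
    χ.hasCompactSupport.comp_left (g := fun r : ℝ => (r : ℂ)) (by simp)
  have hχt : (fun y => (χ y : ℂ)).HasTemperateGrowth :=
    hχc.hasTemperateGrowth (Complex.ofRealCLM.contDiff.comp hχd)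
  set P : 𝓢(EuclideanSpace ℝ (Fin d), ℂ) :=
    SchwartzMap.smulLeftCLM ℂ (fun y => (χ y : ℂ)) K with hP
  have hPy : ∀ y, P y = (χ y : ℂ) * K y := fun y => by
    rw [hP, SchwartzMap.smulLeftCLM_apply_apply hχt, smul_eq_mul]
  have hPts : tsupport P ⊆ Metric.closedBall 0 (7 / 8) := by
    have h1 : tsupport P ⊆ tsupport χ := closure_mono fun y hy => by
      simp only [Function.mem_support, hPy] at hy ⊢
      intro h0; simp [h0] at hy
    exact h1.trans χ.tsupport_eq.subset
  have hP0 : f P = 0 := by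
    refine eq_zero_of_tsupport_subset_compl_dsupport f P
      (HasCompactSupport.of_support_subset_isCompact (isCompact_closedBall 0 (7 / 8))
        ((subset_tsupport _).trans hPts)) fun y hy hy' => ?_
    have h1 : ‖y‖ ≤ 7 / 8 := by simpa using hPts hy
    have h2 : 1 ≤ ‖y‖ := hf hy'
    linarith
  set ψ : EuclideanSpace ℝ (Fin d) → ℝ := fun y => (1 - χ y) * heatKernelFun t (y - x) with hψ
  have hφy : ∀ y, (K - P) y = (ψ y : ℂ) := fun y => by
    rw [sub_apply, hPy, hKy, hψ]; push_cast; ring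
  have hfar : ∀ y : EuclideanSpace ℝ (Fin d), 3 / 4 ≤ ‖y‖ → 1 / 4 ≤ ‖y - x‖ := fun y hy => by
    have := norm_sub_norm_le y x
    linarith
  have hχ1 : ∀ y : EuclideanSpace ℝ (Fin d), ‖y‖ < 3 / 4 → χ y = 1 := fun y hy =>
    χ.one_of_mem_closedBall (by simpa using hy.le)
  have hχ' : ∀ y : EuclideanSpace ℝ (Fin d), ‖y‖ < 3 / 4 → fderiv ℝ χ y = 0 := fun y hy => by
    have h1 : (χ : EuclideanSpace ℝ (Fin d) → ℝ) =ᶠ[nhds y] fun _ => 1 := by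
      filter_upwards [(isOpen_lt continuous_norm continuous_const).mem_nhds hy] with z hz
      exact hχ1 z hz
    rw [h1.fderiv_eq]; simp
  have hχle : ∀ y, |1 - χ y| ≤ 1 := fun y => by
    rw [abs_of_nonneg (by linarith [χ.le_one (x := y)])]
    linarith [χ.nonneg (x := y)]
  refine ⟨K - P, by rw [map_sub, hP0, sub_zero]; rfl, fun y => ?_, fun j y => ?_⟩
  · rw [hφy, Complex.norm_real, hψ, Real.norm_eq_abs, abs_mul, abs_of_nonneg (hk0 _)]
    by_cases hy : ‖y‖ < 3 / 4
    · rw [hχ1 y hy]; simp only [sub_self, abs_zero, zero_mul]; positivity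
    · push Not at hy
      have h1 := (hB t ht ht1 _ (hfar y hy)).1
      have h2 : 0 ≤ M * B * Real.exp (-(1 / 8) * ‖y - x‖ ^ 2) := by positivity
      have h3 := mul_le_mul_of_nonneg_right (hχle y) (hk0 (y - x))
      linarith
  · obtain ⟨L, hL, hLn⟩ := exists_hasFDerivAt_heatKernelFun ht (y - x)
    have h1 : HasFDerivAt (fun y => heatKernelFun t (y - x)) L y := by
      have h0 := hL.comp y ((hasFDerivAt_id (𝕜 := ℝ) y).sub_const x)
      rw [ContinuousLinearMap.comp_id] at h0
      exact h0
    have h2 : HasFDerivAt (fun y => 1 - χ y) (-fderiv ℝ χ y) y :=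
      ((hχd.differentiable (by simp)) y).hasFDerivAt.const_sub 1
    have h3 : HasFDerivAt ψ ((1 - χ y) • L + heatKernelFun t (y - x) • -fderiv ℝ χ y) y :=
      h2.mul h1
    have h4 : HasFDerivAt (K - P : 𝓢(EuclideanSpace ℝ (Fin d), ℂ))
        (Complex.ofRealCLM.comp
          ((1 - χ y) • L + heatKernelFun t (y - x) • -fderiv ℝ χ y)) y := by
      have h5 := Complex.ofRealCLM.hasFDerivAt.comp y h3
      have h6 : (Complex.ofRealCLM ∘ ψ) = (K - P : 𝓢(EuclideanSpace ℝ (Fin d), ℂ)) :=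
        funext fun y => (hφy y).symm
      rwa [h6] at h5
    rw [SchwartzMap.lineDerivOp_apply_eq_fderiv, h4.fderiv, ContinuousLinearMap.comp_apply,
      Complex.ofRealCLM_apply, Complex.norm_real]
    refine (ContinuousLinearMap.le_opNorm _ _).trans ?_
    rw [PiLp.norm_single, norm_one, mul_one]
    refine (norm_add_le _ _).trans ?_
    rw [norm_smul, norm_smul, norm_neg, Real.norm_eq_abs, Real.norm_eq_abs, abs_of_nonneg (hk0 _)]
    by_cases hy : ‖y‖ < 3 / 4
    · rw [hχ1 y hy, hχ' y hy]; simp only [sub_self, abs_zero, zero_mul, norm_zero, mul_zero,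
        add_zero]; positivity
    · push Not at hy
      obtain ⟨h5, h6⟩ := hB t ht ht1 _ (hfar y hy)
      calc |1 - χ y| * ‖L‖ + heatKernelFun t (y - x) * ‖fderiv ℝ χ y‖
          ≤ 1 * (B * Real.exp (-(1 / 8) * ‖y - x‖ ^ 2)) +
            (B * Real.exp (-(1 / 8) * ‖y - x‖ ^ 2)) * M := by
            gcongr
            · exact hχle y
            · exact hLn.trans h6
            · exact hM y
        _ = _ := by ring

/-- Small times: in the ball `|x| ≤ 1/2` the heat flow is bounded for `t ≤ 1`. -/
theorem enorm_heatFlow_le_of_le_one {d : ℕ} (hd : 2 ≤ d) {δ : ℝ} (h1 : -1 ≤ δ) (h2 : δ < 1) :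
    ∃ C : ℝ≥0, ∀ (f : 𝓢'(EuclideanSpace ℝ (Fin d), ℂ)) (g G : EuclideanSpace ℝ (Fin d) → ℂ),
      HasFourierFunction f g → StronglyMeasurable G →
      (G =ᵐ[volume] fun ξ => (((2 * Real.pi * ‖ξ‖) ^ δ : ℝ) : ℂ) * g ξ) →
      Distribution.dsupport f ⊆ {x | 1 ≤ ‖x‖} → ∀ t : ℝ, 0 < t → t ≤ 1 →
      ∀ x : EuclideanSpace ℝ (Fin d), ‖x‖ ≤ 1 / 2 →
        ‖heatFlow f t x‖ₑ ≤ C * eLpNorm G 2 := by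
  obtain ⟨B, hB0, hB⟩ := exists_testFunction_heatFlow (d := d) (by omega)
  obtain ⟨C, hC⟩ := lintegral_rpow_mul_fourier_sq_le hd h1 h2
  refine ⟨((C : ℝ≥0∞) * ENNReal.ofReal B ^ 2).toNNReal ^ (1 / 2 : ℝ),
    fun f g G hg hGm hG hf t ht ht1 x hx => ?_⟩
  obtain ⟨φ, hφ, hφ1, hφ2⟩ := hB f hf t ht ht1 x hx
  have h3 := hC φ B x hB0 hφ1 hφ2
  have h4 : ∫⁻ ξ : EuclideanSpace ℝ (Fin d),
      (ENNReal.ofReal ((2 * Real.pi * ‖ξ‖) ^ (-δ)) * ‖𝓕⁻ φ ξ‖ₑ) ^ (2 : ℝ) ≤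
        C * ENNReal.ofReal B ^ 2 := by
    refine le_trans (le_of_eq ?_) h3
    -- The weight is even, so ξ ↦ -ξ exchanges 𝓕⁻ and 𝓕.
    rw [← lintegral_neg_eq_self]
    refine lintegral_congr fun ξ => ?_
    rw [ENNReal.rpow_two, mul_pow, ← ENNReal.ofReal_pow (by positivity),
      ← Real.rpow_mul_natCast (by positivity), norm_neg, SchwartzMap.fourierInv_coe,
      Real.fourierInv_eq_fourier_neg, neg_neg, SchwartzMap.fourier_coe]
    congr 4
    push_cast; ring
  -- Inserting ρ^{-δ} ρ^δ = 1 prepares Cauchy–Schwarz between ρ^{-δ} 𝓕⁻φ and G.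
  have h5 : ∀ᵐ ξ : EuclideanSpace ℝ (Fin d), ‖𝓕⁻ φ ξ * g ξ‖ₑ =
      ENNReal.ofReal ((2 * Real.pi * ‖ξ‖) ^ (-δ)) * ‖𝓕⁻ φ ξ‖ₑ * ‖G ξ‖ₑ := by
    filter_upwards [hG, ae_norm_pos (by omega : 1 ≤ d)] with ξ h6 h7
    rw [h6, enorm_mul, enorm_mul, ← ofReal_norm (((2 * Real.pi * ‖ξ‖) ^ δ : ℝ) : ℂ),
      Complex.norm_real, Real.norm_of_nonneg (by positivity)]
    have h8 : ENNReal.ofReal ((2 * Real.pi * ‖ξ‖) ^ (-δ)) *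
        ENNReal.ofReal ((2 * Real.pi * ‖ξ‖) ^ δ) = 1 := by
      rw [← ENNReal.ofReal_mul (by positivity), ← Real.rpow_add (by positivity)]
      simp
    calc ‖𝓕⁻ φ ξ‖ₑ * ‖g ξ‖ₑ = (ENNReal.ofReal ((2 * Real.pi * ‖ξ‖) ^ (-δ)) *
        ENNReal.ofReal ((2 * Real.pi * ‖ξ‖) ^ δ)) * (‖𝓕⁻ φ ξ‖ₑ * ‖g ξ‖ₑ) := by rw [h8, one_mul]
      _ = _ := by ring
  have hCB : (C : ℝ≥0∞) * ENNReal.ofReal B ^ 2 ≠ ∞ :=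
    ENNReal.mul_ne_top ENNReal.coe_ne_top (ENNReal.pow_ne_top ENNReal.ofReal_ne_top)
  have hφm : AEMeasurable (fun ξ : EuclideanSpace ℝ (Fin d) =>
      ENNReal.ofReal ((2 * Real.pi * ‖ξ‖) ^ (-δ)) * ‖𝓕⁻ φ ξ‖ₑ) := by
    have h9 : Measurable fun ξ : EuclideanSpace ℝ (Fin d) => ‖𝓕⁻ φ ξ‖ₑ :=
      (SchwartzMap.continuous _).enorm.measurable
    exact (Measurable.mul (by fun_prop) h9).aemeasurable
  calc ‖heatFlow f t x‖ₑ = ‖∫ ξ, 𝓕⁻ φ ξ * g ξ‖ₑ := by rw [hφ, hg.apply_eq]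
    _ ≤ ∫⁻ ξ, ‖𝓕⁻ φ ξ * g ξ‖ₑ := enorm_integral_le_lintegral_enorm _
    _ = ∫⁻ ξ, ENNReal.ofReal ((2 * Real.pi * ‖ξ‖) ^ (-δ)) * ‖𝓕⁻ φ ξ‖ₑ * ‖G ξ‖ₑ :=
        lintegral_congr_ae h5
    _ ≤ (∫⁻ ξ, (ENNReal.ofReal ((2 * Real.pi * ‖ξ‖) ^ (-δ)) * ‖𝓕⁻ φ ξ‖ₑ) ^ (2 : ℝ)) ^ (1 / 2 : ℝ) *
        (∫⁻ ξ, ‖G ξ‖ₑ ^ (2 : ℝ)) ^ (1 / 2 : ℝ) :=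
        ENNReal.lintegral_mul_le_Lp_mul_Lq volume Real.HolderConjugate.two_two hφm
          hGm.measurable.enorm.aemeasurable
    _ ≤ (C * ENNReal.ofReal B ^ 2) ^ (1 / 2 : ℝ) * eLpNorm G 2 := by
        refine mul_le_mul' (ENNReal.rpow_le_rpow h4 (by norm_num)) (le_of_eq ?_)
        rw [eLpNorm_eq_lintegral_rpow_enorm_toReal (by norm_num) (by norm_num)]
        norm_num
    _ = _ := by
        rw [ENNReal.coe_rpow_of_nonneg _ (by norm_num), ENNReal.coe_toNNReal hCB]

/-! ### Large times, and the estimate near the origin. -/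

/-- Large times: the heat flow decays uniformly in space. -/
theorem enorm_fourier_heatSymbol_neg_le {d : ℕ} (hd : 1 ≤ d) {δ : ℝ} (hδ : δ < 2)
    (hδd : δ < (d : ℝ) / 2) :
    ∃ C : ℝ, 0 < C ∧ ∀ G : EuclideanSpace ℝ (Fin d) → ℂ, MemLp G 2 → StronglyMeasurable G →
      (∀ t, 0 < t → Integrable (heatSymbol (-δ) t G)) → ∀ t, 0 < t → ∀ x,
        ‖𝓕 (heatSymbol (-δ) t G) x‖ₑ ≤
          ENNReal.ofReal (C * t ^ (-((d : ℝ) / 4 - δ / 2))) * eLpNorm G 2 := by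
  have ha0 : 0 < -δ + 2 := by linarith
  obtain ⟨C, hC0, hC⟩ := enorm_fourier_heatSymbol_le (d := d) ha0
  -- The time derivative is bounded by s^{-1-b}; its tail integral converges because δ < d/2.
  set b := (d : ℝ) / 4 - δ / 2 with hb
  have hb0 : 0 < b := by rw [hb]; linarith
  refine ⟨C / b, by positivity, fun G hG hGm hint t ht x => ?_⟩
  calc ‖𝓕 (heatSymbol (-δ) t G) x‖ₑ
      ≤ ∫⁻ s in Ioi t, ‖𝓕 (heatSymbol (-δ + 2) s G) x‖ₑ :=
        enorm_fourier_heatSymbol_le_lintegral_Ioi hd ha0 hG hGm hint x ht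
    _ ≤ ∫⁻ s in Ioi t, ENNReal.ofReal (s ^ (-1 - b)) * (ENNReal.ofReal C * eLpNorm G 2) := by
        refine setLIntegral_mono' measurableSet_Ioi fun s hs => ?_
        have hs0 : 0 < s := ht.trans hs
        refine (hC G s hs0 hG x).trans (le_of_eq ?_)
        rw [mul_comm C, ENNReal.ofReal_mul (by positivity), mul_assoc,
          show -((-δ + 2) / 2) - (d : ℝ) / 4 = -1 - b by rw [hb]; ring]
    _ = _ := by
        rw [lintegral_mul_const' _ _ (ENNReal.mul_ne_top ENNReal.ofReal_ne_top hG.2.ne),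
          lintegral_Ioi_rpow_neg hb0 ht, ← mul_assoc, ← ENNReal.ofReal_mul (by positivity)]
        congr 2; ring

/-- The space-time estimate in the ball `|x| < 1/2`. -/
theorem interior_estimate {d : ℕ} (hd : 2 ≤ d) {q δ : ℝ} (hq : 0 < q) (h1 : -1 ≤ δ) (h2 : δ < 1)
    (h3 : δ < (d : ℝ) / 2 - 2 / q) :
    ∃ C : ℝ≥0, ∀ (f : 𝓢'(EuclideanSpace ℝ (Fin d), ℂ)) (g G : EuclideanSpace ℝ (Fin d) → ℂ),
      IsRadialDistribution f → HasFourierFunction f g → StronglyMeasurable G → MemLp G 2 →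
      (G =ᵐ[volume] fun ξ => (((2 * Real.pi * ‖ξ‖) ^ δ : ℝ) : ℂ) * g ξ) →
      Distribution.dsupport f ⊆ {x | 1 ≤ ‖x‖} →
      ∫⁻ x in {x : EuclideanSpace ℝ (Fin d) | 1 / 2 ≤ ‖x‖}ᶜ,
        ∫⁻ t in Ioi 0, ‖𝓕 (heatSymbol (-δ) t G) x‖ₑ ^ q ≤ C * eLpNorm G 2 ^ q := by
  have hq2 : 0 < 2 / q := by positivity
  obtain ⟨C₁, hC₁⟩ := enorm_heatFlow_le_of_le_one hd h1 h2
  obtain ⟨C₂, hC₂0, hC₂⟩ := enorm_fourier_heatSymbol_neg_le (d := d) (by omega) (δ := δ)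
    (by linarith) (by linarith)
  set b := (d : ℝ) / 4 - δ / 2 with hb
  -- This is δ < d/2 - 2/q rewritten: it makes t^{-qb} integrable at infinity.
  have hqb : 0 < q * b - 1 := by
    have : q * (2 / q) = 2 := by field_simp
    have h4 : q * δ < q * ((d : ℝ) / 2 - 2 / q) := mul_lt_mul_of_pos_left h3 hq
    rw [hb]
    linarith
  set S : Set (EuclideanSpace ℝ (Fin d)) := {x | 1 / 2 ≤ ‖x‖}ᶜ with hS
  have hSv : volume S ≠ ∞ := by
    have h4 : S ⊆ Metric.closedBall 0 (1 / 2) := fun x hx => by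
      simp only [hS, mem_compl_iff, mem_ofPred_eq, not_le] at hx
      simpa using hx.le
    exact ((measure_mono h4).trans_lt measure_closedBall_lt_top).ne
  have hSm : MeasurableSet S := (measurableSet_le measurable_const measurable_norm).compl
  set A : ℝ≥0∞ := (C₁ : ℝ≥0∞) ^ q + ENNReal.ofReal (C₂ ^ q / (q * b - 1)) with hA
  have hAt : A ≠ ∞ := ENNReal.add_ne_top.2
    ⟨ENNReal.rpow_ne_top_of_nonneg hq.le ENNReal.coe_ne_top, ENNReal.ofReal_ne_top⟩
  refine ⟨(A * volume S).toNNReal, fun f g G hf hg hGm hG hGg hfs => ?_⟩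
  set N := eLpNorm G 2 volume with hN
  have hNt : N ^ q ≠ ∞ := ENNReal.rpow_ne_top_of_nonneg hq.le hG.2.ne
  have hint : ∀ t, 0 < t → Integrable (heatSymbol (-δ) t G) := fun t ht =>
    (heatFlow_eq_fourierInv_heatSymbol (by omega) hg hGg ht).1
  have hpt : ∀ x ∈ S, ∫⁻ t in Ioi 0, ‖𝓕 (heatSymbol (-δ) t G) x‖ₑ ^ q ≤ A * N ^ q := fun x hx => by
    have hx' : ‖x‖ ≤ 1 / 2 := by
      simp only [hS, mem_compl_iff, mem_ofPred_eq, not_le] at hx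
      exact hx.le
    have hs : ∫⁻ t in Ioc (0 : ℝ) 1, ‖𝓕 (heatSymbol (-δ) t G) x‖ₑ ^ q ≤
        (C₁ : ℝ≥0∞) ^ q * N ^ q := by
      calc ∫⁻ t in Ioc (0 : ℝ) 1, ‖𝓕 (heatSymbol (-δ) t G) x‖ₑ ^ q
          ≤ ∫⁻ t in Ioc (0 : ℝ) 1, (C₁ : ℝ≥0∞) ^ q * N ^ q := by
            refine setLIntegral_mono' measurableSet_Ioc fun t ht => ?_
            rw [← ENNReal.mul_rpow_of_nonneg _ _ hq.le,
              ← hf.heatFlow_eq_fourier_heatSymbol (by omega) hg hGg ht.1]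
            exact ENNReal.rpow_le_rpow (hC₁ f g G hg hGm hGg hfs t ht.1 ht.2 x hx') hq.le
        _ = _ := by simp
    have hl : ∫⁻ t in Ioi (1 : ℝ), ‖𝓕 (heatSymbol (-δ) t G) x‖ₑ ^ q ≤
        ENNReal.ofReal (C₂ ^ q / (q * b - 1)) * N ^ q := by
      calc ∫⁻ t in Ioi (1 : ℝ), ‖𝓕 (heatSymbol (-δ) t G) x‖ₑ ^ q
          ≤ ∫⁻ t in Ioi (1 : ℝ), ENNReal.ofReal (t ^ (-1 - (q * b - 1))) *
              (ENNReal.ofReal (C₂ ^ q) * N ^ q) := by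
            refine setLIntegral_mono' measurableSet_Ioi fun t ht => ?_
            have ht0 : (0 : ℝ) < t := one_pos.trans ht
            refine (ENNReal.rpow_le_rpow (hC₂ G hG hGm hint t ht0 x) hq.le).trans (le_of_eq ?_)
            rw [ENNReal.mul_rpow_of_nonneg _ _ hq.le,
              ENNReal.ofReal_rpow_of_nonneg (by positivity) hq.le,
              Real.mul_rpow hC₂0.le (by positivity), ← Real.rpow_mul ht0.le, mul_comm (C₂ ^ q),
              ENNReal.ofReal_mul (by positivity), mul_assoc]
            congr 3; ring_nf
        _ = _ := by
            rw [lintegral_mul_const' _ _ (ENNReal.mul_ne_top ENNReal.ofReal_ne_top hNt),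
              lintegral_Ioi_rpow_neg hqb one_pos, ← mul_assoc,
              ← ENNReal.ofReal_mul (by positivity), Real.one_rpow]
            congr 2; ring
    rw [← Ioc_union_Ioi_eq_Ioi zero_le_one, hA, add_mul]
    exact (lintegral_union_le _ _ _).trans (add_le_add hs hl)
  calc _ ≤ ∫⁻ x in S, A * N ^ q := setLIntegral_mono' hSm hpt
    _ = _ := by
      rw [setLIntegral_const, ENNReal.coe_toNNReal (ENNReal.mul_ne_top hAt hSv)]
      ring

/-! ### Assembly and choice of exponents. -/

/-- The space-time estimate for radial distributions supported in `|x| ≥ 1`, in the full range of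
exponents given by the proof. -/
theorem spaceTimeNorm_heatFlow_le {d : ℕ} (hd : 2 ≤ d) {q δ κ : ℝ} (hq : 2 < q) (h1 : -1 ≤ δ)
    (h2 : δ < 1) (h3 : δ < (d : ℝ) / 2 - 2 / q) (hκ1 : 1 / 2 ≤ κ) (hκ2 : κ ≤ (d : ℝ) / 2)
    (hκ : δ * q + 2 = κ * (q - 2)) :
    ∃ C : ℝ≥0, ∀ f : 𝓢'(EuclideanSpace ℝ (Fin d), ℂ),
      IsRadialDistribution f → Distribution.dsupport f ⊆ {x | 1 ≤ ‖x‖} →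
        spaceTimeNorm q (heatFlow f) ≤ C * fracDerivL2Norm δ f := by
  have hd1 : 1 ≤ d := by omega
  have hq0 : 0 < q := by linarith
  obtain ⟨C₁, hC₁⟩ := exterior_estimate hd1 hq (by linarith) hκ1 hκ2 hκ
  obtain ⟨C₂, hC₂⟩ := interior_estimate hd hq0 h1 h2 h3
  -- The summand 1 keeps C nonzero, so one may divide by it to pass to the infimum defining the
  -- norm; this also covers the case where the norm is ∞.
  set C : ℝ≥0 := (C₁ + C₂ + 1) ^ (1 / q) with hC
  have hC0 : C ≠ 0 := (NNReal.rpow_pos (by positivity)).ne'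
  refine ⟨C, fun f hf hfs => ?_⟩
  suffices h : ∀ h : Lp ℂ 2 (volume : Measure (EuclideanSpace ℝ (Fin d))), IsFracDeriv δ f h →
      spaceTimeNorm q (heatFlow f) ≤ C * ‖h‖ₑ by
    rw [mul_comm, fracDerivL2Norm]
    refine (ENNReal.div_le_iff_le_mul (Or.inl (by exact_mod_cast hC0))
      (Or.inl ENNReal.coe_ne_top)).1 (le_iInf₂ fun u hu => ?_)
    exact ENNReal.div_le_of_le_mul' (h u hu)
  rintro h ⟨g, hg, hGg⟩
  set G : EuclideanSpace ℝ (Fin d) → ℂ :=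
    ⇑(𝓕 h : Lp ℂ 2 (volume : Measure (EuclideanSpace ℝ (Fin d)))) with hGdef
  have hGm : StronglyMeasurable G := Lp.stronglyMeasurable _
  have hG : MemLp G 2 := Lp.memLp _
  have hN : eLpNorm G 2 volume = ‖h‖ₑ := by
    rw [hGdef, ← Lp.enorm_def, ← ofReal_norm, Lp.norm_fourier_eq, ofReal_norm]
  have heq : ∀ t, 0 < t → ∀ x, heatFlow f t x = 𝓕 (heatSymbol (-δ) t G) x := fun t ht x =>
    hf.heatFlow_eq_fourier_heatSymbol hd1 hg hGg ht x
  have hint : ∀ t, 0 < t → Integrable (heatSymbol (-δ) t G) := fun t ht =>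
    (heatFlow_eq_fourierInv_heatSymbol hd1 hg hGg ht).1
  have hrad : ∀ t, 0 < t → IsRadialFun (𝓕 (heatSymbol (-δ) t G)) := fun t ht A x => by
    rw [← heq t ht, ← heq t ht, hf.heatFlow_apply_linearIsometryEquiv ht]
  have hm : Measurable fun z : ℝ × EuclideanSpace ℝ (Fin d) =>
      ‖𝓕 (heatSymbol (-δ) z.1 G) z.2‖ₑ ^ q :=
    (measurable_fourier_heatSymbol (-δ) hGm).measurable.enorm.pow_const q
  have hE : MeasurableSet {x : EuclideanSpace ℝ (Fin d) | 1 / 2 ≤ ‖x‖} :=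
    measurableSet_le measurable_const measurable_norm
  have hae : ∀ᵐ z ∂((volume.restrict (Ioi (0 : ℝ))).prod
      (volume : Measure (EuclideanSpace ℝ (Fin d)))),
      ‖heatFlow f z.1 z.2‖ₑ ^ q = ‖𝓕 (heatSymbol (-δ) z.1 G) z.2‖ₑ ^ q := by
    have h4 : ∀ᵐ t ∂(volume.restrict (Ioi (0 : ℝ))), 0 < t := ae_restrict_mem measurableSet_Ioi
    filter_upwards [Measure.quasiMeasurePreserving_fst.ae h4] with z hz
    rw [heq z.1 hz]
  have hmain : ∫⁻ z, ‖heatFlow f z.1 z.2‖ₑ ^ q ∂((volume.restrict (Ioi (0 : ℝ))).prod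
      (volume : Measure (EuclideanSpace ℝ (Fin d)))) ≤ (C₁ + C₂ + 1) * ‖h‖ₑ ^ q := by
    rw [lintegral_congr_ae hae, lintegral_prod_symm _ hm.aemeasurable,
      ← lintegral_add_compl _ hE, ← hN]
    refine (add_le_add (hC₁ G hG hGm hint hrad) (hC₂ f g G hf hg hGm hG hGg hfs)).trans ?_
    rw [← add_mul]
    exact mul_le_mul' le_self_add le_rfl
  rw [spaceTimeNorm, eLpNorm_eq_lintegral_rpow_enorm_toReal (by simpa using hq0)
    ENNReal.ofReal_ne_top, ENNReal.toReal_ofReal hq0.le]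
  calc _ ≤ ((C₁ + C₂ + 1) * ‖h‖ₑ ^ q) ^ (1 / q) := ENNReal.rpow_le_rpow hmain (by positivity)
    _ = C * ‖h‖ₑ := by
      rw [ENNReal.mul_rpow_of_nonneg _ _ (by positivity), ← ENNReal.rpow_mul,
        mul_one_div_cancel hq0.ne', ENNReal.rpow_one, hC, ENNReal.coe_rpow_of_nonneg _ (by positivity)]
      push_cast
      rfl

end

theorem lemma3p2 (d : ℕ) (hd : 2 ≤ d) :
    (∀ q δ : ℝ, 2 < q → 1 / 2 - 3 / q < δ → δ < 1 - 4 / q →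
      ∃ C : ℝ≥0, ∀ f : 𝓢'(EuclideanSpace ℝ (Fin d), ℂ),
        IsRadialDistribution f → Distribution.dsupport f ⊆ {x | 1 ≤ ‖x‖} →
          spaceTimeNorm q (heatFlow f) ≤ C * fracDerivL2Norm δ f) ∧
    (∀ γ₀ : ℝ, 0 ≤ γ₀ → γ₀ < ((d : ℝ) - 1) / ((d : ℝ) + 2) →
      ∃ C : ℝ≥0, ∀ h₀ : 𝓢'(EuclideanSpace ℝ (Fin d), ℂ),
        IsRadialDistribution h₀ → Distribution.dsupport h₀ ⊆ {x | 1 ≤ ‖x‖} →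
          spaceTimeNorm (2 + 4 / (d : ℝ)) (heatFlow h₀) ≤ C * fracDerivL2Norm (-γ₀) h₀) := by
  have hd2 : (2 : ℝ) ≤ d := by exact_mod_cast hd
  refine ⟨fun q δ hq h1 h2 => ?_, fun γ₀ h0 h1 => ?_⟩
  · have hq0 : 0 < q := by linarith
    have hq2 : q - 2 ≠ 0 := by linarith
    have h3 : 3 / q < 3 / 2 := div_lt_div_of_pos_left (by norm_num) (by norm_num) hq
    have h4 : 0 < 1 / q := by positivity
    have h5 : q * (1 / q) = 1 := by field_simp
    have e2 : 2 / q = 2 * (1 / q) := by ring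
    have e3 : 3 / q = 3 * (1 / q) := by ring
    have e4 : 4 / q = 4 * (1 / q) := by ring
    rw [e3] at h1 h3
    rw [e4] at h2
    -- The scaling relation determines κ. The condition δ > 1/2 - 3/q says κ > 1/2, and δ < 1 - 4/q
    -- says κ < 1, which is at most d/2.
    refine spaceTimeNorm_heatFlow_le hd (κ := (δ * q + 2) / (q - 2)) hq (by linarith)
      (by linarith) (by rw [e2]; linarith) ?_ ?_ (by field_simp)
    · rw [le_div_iff₀ (by linarith)]
      nlinarith
    · rw [div_le_iff₀ (by linarith)]
      nlinarith
  · have hd0 : (0 : ℝ) < d := by linarith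
    rw [lt_div_iff₀ (by linarith)] at h1
    have h4 : 0 < 4 / (d : ℝ) := by positivity
    have h5 : 2 / (2 + 4 / (d : ℝ)) = d / (d + 2) := by field_simp; ring
    have h6 : (d : ℝ) / (d + 2) < d / 2 :=
      div_lt_div_of_pos_left hd0 (by norm_num) (by linarith)
    have h7 : γ₀ < 1 := by nlinarith
    -- The scaling relation for q = 2 + 4/d and δ = -γ₀. Here κ ≤ d/2 is γ₀ ≥ 0, and κ ≥ 1/2 is γ₀ ≤
    -- (d - 1)/(d + 2).
    refine spaceTimeNorm_heatFlow_le hd (κ := d / 2 - γ₀ * (d + 2) / 2) (by linarith) (by linarith)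
      (by linarith) ?_ (by linarith) ?_ ?_
    · rw [h5]; linarith
    · have : 0 ≤ γ₀ * (d + 2) := by positivity
      linarith
    · field_simp
      ring
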